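/- Let $N\in\mathbb{N}$ and let $(\rho_n)_{n\in\mathbb{N}}$ be a sequence of radial functions $\rho_n:\mathbb{R}^N\to\mathbb{R}$ such that $\rho_n\ge 0$ and $\int_{\mathbb{R}^N}\rho_n(x)\,dx=1$ for all $n$, and $\lim_{n\to\infty}\int_{|x|>\gamma}\rho_n(x)\,dx=0$ for every $\gamma>0$. For $u:\mathbb{R}^N\to\mathbb{R}$ define the non-local Hessian $$H_nu(x)=\frac{N(N+2)}{2}\int_{\mathbb{R}^N}\frac{u(x+h)-2u(x)+u(x-h)}{|h|^2}\,\frac{h\otimes h-\frac{|h|^2}{N+2}I_N}{|h|^2}\,\rho_n(h)\,dh ,$$ where $I_N$ is the $N\times N$ identity matrix. Let $1\le p<\infty$ and let $u\in W^{2,p}(\mathbb{R}^N)$, with weak Hessian $\nabla^2u\in L^p(\mathbb{R}^N,\mathbb{R}^{N\times N})$. Then, for every $n$, the integral defining $H_nu(x)$ converges absolutely for almost every $x\in\mathbb{R}^N$, $H_nu\in L^p(\mathbb{R}^N,\mathbb{R}^{N\times N})$, and $$H_nu\to\nabla^2u\quad\text{in }L^p(\mathbb{R}^N,\mathbb{R}^{N\times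 N})\quad\text{as }n\to\infty,$$ where $\mathbb{R}^{N\times N}$ carries the Frobenius norm. -/

import Mathlib

open MeasureTheory Filter
open scoped ENNReal Topology ContDiff

noncomputable section

namespace NonlocalHessian

/-- The space `ℝ^{N×N}` of real matrices with the Frobenius norm; the `(i,j)` entry of `A` is
`A (i, j)`. -/
abbrev Mat (N : ℕ) : Type := EuclideanSpace ℝ (Fin N × Fin N)

/-- The classical partial derivative `∂φ/∂xᵢ` of a (differentiable) function on `ℝᴺ`. -/
def partialDeriv {N : ℕ} (i : Fin N) (φ : EuclideanSpace ℝ (Fin N) → ℝ) :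
    EuclideanSpace ℝ (Fin N) → ℝ :=
  fun x => fderiv ℝ φ x (EuclideanSpace.single i 1)

/-- `g` is a weak partial derivative `∂u/∂xᵢ`. -/
structure IsWeakPartialDeriv {N : ℕ} (i : Fin N) (u g : EuclideanSpace ℝ (Fin N) → ℝ) :
    Prop where
  locallyIntegrable : LocallyIntegrable u volume
  locallyIntegrable_deriv : LocallyIntegrable g volume
  integral_eq : ∀ φ : EuclideanSpace ℝ (Fin N) → ℝ, ContDiff ℝ ∞ φ → HasCompactSupport φ →
    ∫ x, u x * partialDeriv i φ x = - ∫ x, g x * φ x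

/-- `D` is a weak Hessian `∇²u`: its entries are the weak second partial derivatives of `u`. -/
structure IsWeakHessian {N : ℕ} (u : EuclideanSpace ℝ (Fin N) → ℝ)
    (D : EuclideanSpace ℝ (Fin N) → Mat N) : Prop where
  locallyIntegrable : LocallyIntegrable u volume
  locallyIntegrable_hessian : LocallyIntegrable D volume
  integral_eq : ∀ i j : Fin N, ∀ φ : EuclideanSpace ℝ (Fin N) → ℝ,
    ContDiff ℝ ∞ φ → HasCompactSupport φ →
    ∫ x, u x * partialDeriv i (partialDeriv j φ) x = ∫ x, D x (i, j) * φ x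

/-- `u ∈ W^{2,p}(ℝᴺ)`: `u` and its weak derivatives of first and second order
exist and lie in `Lᵖ`. -/
structure MemW2p {N : ℕ} (p : ℝ≥0∞) (u : EuclideanSpace ℝ (Fin N) → ℝ) : Prop where
  memLp : MemLp u p volume
  exists_weakPartialDeriv : ∀ i : Fin N, ∃ g : EuclideanSpace ℝ (Fin N) → ℝ,
    MemLp g p volume ∧ IsWeakPartialDeriv i u g
  exists_weakHessian : ∃ D : EuclideanSpace ℝ (Fin N) → Mat N,
    MemLp D p volume ∧ IsWeakHessian u D

/-- A sequence of radial mollifiers on `ℝᴺ`. (Integrability of `ρ n` is forced by `integral_eq_one`,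
since the integral of a non-integrable function is `0`.) -/
structure IsRadialMollifierSeq {N : ℕ} (ρ : ℕ → EuclideanSpace ℝ (Fin N) → ℝ) : Prop where
  radial : ∀ n x y, ‖x‖ = ‖y‖ → ρ n x = ρ n y
  nonneg : ∀ n x, 0 ≤ ρ n x
  integral_eq_one : ∀ n, ∫ x, ρ n x = 1
  tendsto_integral_tail : ∀ γ : ℝ, 0 < γ →
    Tendsto (fun n => ∫ x in {x | γ < ‖x‖}, ρ n x) atTop (𝓝 0)

/-- The trace-corrected matrix `(h ⊗ h - |h|²/(N+2) I_N) / |h|²`. -/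
def kernelMatrix {N : ℕ} (h : EuclideanSpace ℝ (Fin N)) : Mat N :=
  WithLp.toLp 2 fun ij =>
    (h ij.1 * h ij.2 - ‖h‖ ^ 2 / ((N : ℝ) + 2) * (if ij.1 = ij.2 then 1 else 0)) / ‖h‖ ^ 2

/-- The matrix-valued integrand, as a function of `h`, in the definition of the non-local
Hessian of `u` at `x` with weight `ρ`. -/
def integrand {N : ℕ} (ρ : EuclideanSpace ℝ (Fin N) → ℝ) (u : EuclideanSpace ℝ (Fin N) → ℝ)
    (x h : EuclideanSpace ℝ (Fin N)) : Mat N :=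
  ((u (x + h) - 2 * u x + u (x - h)) / ‖h‖ ^ 2 * ρ h) • kernelMatrix h

/-- The non-local Hessian of `u` with weight `ρ`, as a Lebesgue integral. -/
def nonlocalHessian {N : ℕ} (ρ : EuclideanSpace ℝ (Fin N) → ℝ)
    (u : EuclideanSpace ℝ (Fin N) → ℝ) (x : EuclideanSpace ℝ (Fin N)) : Mat N :=
  ((N : ℝ) * ((N : ℝ) + 2) / 2) • ∫ h, integrand ρ u x h

end NonlocalHessian

end

noncomputable section

namespace NonlocalHessian

/-! Write `ω = h/|h|` and let `λ` be `differenceLaw`. For smooth `φ`, integrating twice along a line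
expresses the second difference as the `λ`-average of `⟨∇²φ(x + th), h ⊗ h⟩`. Second differences and
line averages pass to the adjoint side by translation, so testing against smooth compactly supported
functions gives the same formula for a weak Hessian `D`, almost everywhere in `x`
(`IsWeakHessian.secondDifference_ae_eq`). No approximation of `u` by smooth functions is needed.

Freeze `D` at `x` in that formula. The frozen term `⟨D x, ω ⊗ ω⟩`, integrated against the
trace-corrected kernel and a radial density, returns exactly `D x`: the fourth moments of `ω` are
isotropic, the correction removes the trace, and `D x` is symmetric for a.e. `x`
(`integral_mul_inner_smul_kernelMatrix`). Hence `H_n u - D` is the integral of the Taylor remainder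
alone against a bounded kernel.

After division by `|h|²`, the remainder is at most the `λ`-average of `|D(x - th) - D x|`. Applying
the integral inequality of `lintegral_rpow_lintegral_le` in `t` and again in `h` bounds the `L^p`
error by a constant times the `1/p` power of the `ρ_n`-average of `translationModulus`
(`exists_eLpNorm_nonlocalHessian_sub_le`). That modulus is bounded and tends to `0` at `h = 0`, by
continuity of translations in `L^p`, while `ρ_n` concentrates at `0`; this gives convergence. Its
boundedness alone gives absolute convergence of the integrals and membership in `L^p`. -/

/-! ### The averaging measure in Taylor's formula -/

/-- The law of `s - t` for independent `s`, `t` uniformly distributed on `[0, 1]`. -/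
def differenceLaw : Measure ℝ :=
  ((volume.restrict (Set.Ioc (0 : ℝ) 1)).prod (volume.restrict (Set.Ioc (0 : ℝ) 1))).map
    fun z => z.1 - z.2

instance : IsProbabilityMeasure (volume.restrict (Set.Ioc (0 : ℝ) 1)) :=
  ⟨by simp⟩

instance : IsProbabilityMeasure differenceLaw :=
  Measure.isProbabilityMeasure_map (by fun_prop)

lemma ae_differenceLaw_abs_le_one : ∀ᵐ t ∂differenceLaw, |t| ≤ 1 := by
  rw [differenceLaw, ae_map_iff (by fun_prop) (measurableSet_le (by fun_prop) (by fun_prop)),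
    Measure.prod_restrict]
  filter_upwards [ae_restrict_mem (measurableSet_Ioc.prod measurableSet_Ioc)] with z hz
  obtain ⟨⟨h1, h2⟩, h3, h4⟩ := hz
  rw [abs_le]
  constructor <;> linarith

/-- The fundamental theorem of calculus applies twice: integrating `g'' (s - t)` over `t` leaves `g'
s - g' (s - 1)`, and integrating that over `s` leaves the second difference. -/
lemma integral_differenceLaw {g g' g'' : ℝ → ℝ} (h1 : ∀ t, HasDerivAt g (g' t) t)
    (h2 : ∀ t, HasDerivAt g' (g'' t) t) (h3 : Continuous g'') :
    ∫ t, g'' t ∂differenceLaw = g 1 - 2 * g 0 + g (-1) := by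
  have hc' : Continuous g' := continuous_iff_continuousAt.2 fun t => (h2 t).continuousAt
  have hint : Integrable (fun z : ℝ × ℝ => g'' (z.1 - z.2))
      ((volume.restrict (Set.Ioc (0 : ℝ) 1)).prod (volume.restrict (Set.Ioc (0 : ℝ) 1))) := by
    rw [Measure.prod_restrict]
    have hc : Continuous fun z : ℝ × ℝ => g'' (z.1 - z.2) := by fun_prop
    exact (hc.continuousOn.integrableOn_compact
      (isCompact_Icc.prod isCompact_Icc)).mono_set
        (Set.prod_mono Set.Ioc_subset_Icc_self Set.Ioc_subset_Icc_self)
  rw [differenceLaw, integral_map (by fun_prop) h3.aestronglyMeasurable, integral_prod _ hint]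
  have inner : ∀ s, ∫ t in Set.Ioc (0 : ℝ) 1, g'' (s - t) = g' s - g' (s - 1) := by
    intro s
    rw [← intervalIntegral.integral_of_le zero_le_one,
      intervalIntegral.integral_comp_sub_left (fun t => g'' t) s,
      intervalIntegral.integral_eq_sub_of_hasDerivAt (fun t _ => h2 t)
        (h3.intervalIntegrable _ _), sub_zero]
  simp only [inner]
  have hc1 : Continuous fun s => g' (s - 1) := by fun_prop
  rw [← intervalIntegral.integral_of_le zero_le_one, intervalIntegral.integral_sub
      (hc'.intervalIntegrable _ _) (hc1.intervalIntegrable _ _),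
    intervalIntegral.integral_comp_sub_right (fun t => g' t) 1,
    intervalIntegral.integral_eq_sub_of_hasDerivAt (fun t _ => h1 t)
        (hc'.intervalIntegrable _ _),
    intervalIntegral.integral_eq_sub_of_hasDerivAt (fun t _ => h1 t)
        (hc'.intervalIntegrable _ _)]
  norm_num
  ring

/-! ### Integral inequalities and continuity of translations in `L^p` -/

lemma rpow_lintegral_le_lintegral_rpow {T : Type*} [MeasurableSpace T] {ν : Measure T}
    [IsProbabilityMeasure ν] {f : T → ℝ≥0∞} (hf : AEMeasurable f ν) {q : ℝ} (hq : 1 ≤ q) :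
    (∫⁻ t, f t ∂ν) ^ q ≤ ∫⁻ t, f t ^ q ∂ν := by
  have h := eLpNorm'_le_eLpNorm'_of_exponent_le zero_lt_one hq ν hf.aestronglyMeasurable
  simp only [eLpNorm', enorm_eq_self, ENNReal.rpow_one, div_one] at h
  calc _ ≤ ((∫⁻ t, f t ^ q ∂ν) ^ (1 / q)) ^ q := by gcongr
    _ = _ := by rw [← ENNReal.rpow_mul, one_div_mul_cancel (by positivity), ENNReal.rpow_one]

/-- **Minkowski's integral inequality** for probability measures, in its `q`-th power form. -/
lemma lintegral_rpow_lintegral_le {T X : Type*} [MeasurableSpace T] [MeasurableSpace X]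
    {ν : Measure T} [IsProbabilityMeasure ν] {μ : Measure X} [SFinite μ]
    {F : T → X → ℝ≥0∞} (hF : AEMeasurable (Function.uncurry F) (ν.prod μ)) {q : ℝ} (hq : 1 ≤ q) :
    ∫⁻ x, (∫⁻ t, F t x ∂ν) ^ q ∂μ ≤ ∫⁻ t, ∫⁻ x, F t x ^ q ∂μ ∂ν := by
  -- Since `ν` has mass one, Tonelli reduces the claim to Jensen's inequality for each fixed `x`.
  rw [lintegral_lintegral_swap (f := fun t x => F t x ^ q) (hF.pow_const q)]
  refine lintegral_mono_ae ?_
  have hs : AEMeasurable (Function.uncurry fun x t => F t x) (μ.prod ν) := hF.prod_swap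
  filter_upwards [hs.aestronglyMeasurable.prodMk_left] with x hx
  exact rpow_lintegral_le_lintegral_rpow hx.aemeasurable hq

lemma eLpNorm_rpow_toReal {X V : Type*} [MeasurableSpace X] [NormedAddCommGroup V]
    {μ : Measure X} {p : ℝ≥0∞} (hp0 : p ≠ 0) (hp : p ≠ ⊤) (f : X → V) :
    eLpNorm f p μ ^ p.toReal = ∫⁻ x, ‖f x‖ₑ ^ p.toReal ∂μ := by
  rw [eLpNorm_eq_lintegral_rpow_enorm_toReal hp0 hp, ← ENNReal.rpow_mul,
    one_div_mul_cancel (ENNReal.toReal_pos hp0 hp).ne', ENNReal.rpow_one]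

/-- The translation group acts continuously on `Lp` for finite `p`; the orbit map of `f` is
therefore continuous at `0`. -/
lemma tendsto_eLpNorm_comp_add_sub {X V : Type*} [NormedAddCommGroup X] [NormedSpace ℝ X]
    [FiniteDimensional ℝ X] [MeasurableSpace X] [BorelSpace X] [NormedAddCommGroup V]
    {μ : Measure X} [μ.IsAddHaarMeasure] {p : ℝ≥0∞} (hp1 : 1 ≤ p) (hp : p ≠ ⊤) {f : X → V}
    (hf : MemLp f p μ) :
    Tendsto (fun s => eLpNorm (fun x => f (s + x) - f x) p μ) (𝓝 0) (𝓝 0) := by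
  have : Fact (1 ≤ p) := ⟨hp1⟩
  have : Fact (p ≠ ⊤) := ⟨hp⟩
  have hc : Continuous fun s : X => DomAddAct.mk s +ᵥ hf.toLp f :=
    (continuous_vadd (M := Xᵈᵃᵃ) (X := Lp V p μ)).comp
      ((DomAddAct.continuous_mk).prodMk continuous_const)
  have h0 : Tendsto (fun s : X => edist (DomAddAct.mk s +ᵥ hf.toLp f) (hf.toLp f)) (𝓝 0)
      (𝓝 0) := by
    have := (hc.edist (continuous_const (y := hf.toLp f))).tendsto 0
    simpa using this
  refine h0.congr fun s => ?_
  rw [DomAddAct.mk_vadd_toLp, Lp.edist_toLp_toLp]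
  rfl

/-! ### Tensor squares and second differences -/

/-- The tensor square `h ⊗ h`. -/
def tensorSquare {N : ℕ} (h : EuclideanSpace ℝ (Fin N)) : Mat N :=
  WithLp.toLp 2 fun ij => h ij.1 * h ij.2

lemma norm_tensorSquare {N : ℕ} (h : EuclideanSpace ℝ (Fin N)) :
    ‖tensorSquare h‖ = ‖h‖ ^ 2 := by
  rw [← sq_eq_sq₀ (norm_nonneg _) (by positivity), EuclideanSpace.real_norm_sq_eq,
    EuclideanSpace.real_norm_sq_eq, sq (∑ i, _), Finset.sum_mul_sum, Fintype.sum_prod_type]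
  simp [tensorSquare, mul_pow]

lemma inner_tensorSquare {N : ℕ} (A : Mat N) (h : EuclideanSpace ℝ (Fin N)) :
    inner ℝ A (tensorSquare h) = ∑ i, ∑ j, A (i, j) * (h i * h j) := by
  simp only [PiLp.inner_apply, tensorSquare, Fintype.sum_prod_type]
  simp [mul_comm]

lemma continuous_tensorSquare {N : ℕ} :
    Continuous (tensorSquare : EuclideanSpace ℝ (Fin N) → Mat N) := by
  unfold tensorSquare
  fun_prop

/-- The second difference `u (x + h) - 2 u x + u (x - h)`. -/
def secondDifference {N : ℕ} (u : EuclideanSpace ℝ (Fin N) → ℝ)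
    (h x : EuclideanSpace ℝ (Fin N)) : ℝ :=
  u (x + h) - 2 * u x + u (x - h)

/-! ### Taylor's formula for smooth functions -/

section Classical

variable {N : ℕ} {φ : EuclideanSpace ℝ (Fin N) → ℝ}

lemma contDiff_partialDeriv (hφ : ContDiff ℝ ∞ φ) (i : Fin N) :
    ContDiff ℝ ∞ (partialDeriv i φ) :=
  (hφ.fderiv_right (m := ∞) (by simp)).clm_apply contDiff_const

lemma hasCompactSupport_partialDeriv (hφ : HasCompactSupport φ) (i : Fin N) :
    HasCompactSupport (partialDeriv i φ) :=
  hφ.fderiv_apply (𝕜 := ℝ) _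

lemma partialDeriv_comm (hφ : ContDiff ℝ ∞ φ) (i j : Fin N) (x : EuclideanSpace ℝ (Fin N)) :
    partialDeriv i (partialDeriv j φ) x = partialDeriv j (partialDeriv i φ) x := by
  have hd : DifferentiableAt ℝ (fderiv ℝ φ) x :=
    ((hφ.fderiv_right (m := ∞) (by simp)).differentiable (by simp)) x
  have key : ∀ i j : Fin N, partialDeriv i (partialDeriv j φ) x =
      fderiv ℝ (fderiv ℝ φ) x (EuclideanSpace.single i 1) (EuclideanSpace.single j 1) := by
    intro i j
    unfold partialDeriv
    rw [fderiv_clm_apply hd (differentiableAt_const _)]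
    simp
  rw [key, key]
  have h2 : (2 : WithTop ℕ∞) ≤ ((⊤ : ℕ∞) : WithTop ℕ∞) := WithTop.coe_le_coe.2 (le_top (a := (2 : ℕ∞)))
  exact (hφ.contDiffAt.isSymmSndFDerivAt (by simpa using h2)).eq _ _

lemma hasDerivAt_comp_line (hφ : ContDiff ℝ ∞ φ) (x h : EuclideanSpace ℝ (Fin N)) (t : ℝ) :
    HasDerivAt (fun t : ℝ => φ (x + t • h)) (∑ i, h i * partialDeriv i φ (x + t • h)) t := by
  have hl : HasDerivAt (fun t : ℝ => x + t • h) h t := by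
    simpa using ((hasDerivAt_id t).smul_const h).const_add x
  have hd := ((hφ.differentiable (by simp)) (x + t • h)).hasFDerivAt.comp_hasDerivAt t hl
  have hs : fderiv ℝ φ (x + t • h) h = ∑ i, h i * partialDeriv i φ (x + t • h) := by
    generalize x + t • h = y
    conv_lhs => rw [← (EuclideanSpace.basisFun (Fin N) ℝ).sum_repr h]
    simp [partialDeriv]
  rwa [hs] at hd

/-- The classical Hessian. -/
def hessian (φ : EuclideanSpace ℝ (Fin N) → ℝ) (x : EuclideanSpace ℝ (Fin N)) : Mat N :=
  WithLp.toLp 2 fun ij => partialDeriv ij.1 (partialDeriv ij.2 φ) x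

lemma continuous_hessian (hφ : ContDiff ℝ ∞ φ) : Continuous (hessian φ) := by
  have := fun i j => (contDiff_partialDeriv (contDiff_partialDeriv hφ j) i).continuous
  unfold hessian
  fun_prop

lemma hasCompactSupport_inner_hessian (hφ : HasCompactSupport φ) (A : Mat N) :
    HasCompactSupport fun x => inner ℝ (hessian φ x) A := by
  refine HasCompactSupport.intro hφ fun x hx => ?_
  have : hessian φ x = 0 := by
    ext ij
    have h2 := (tsupport_fderiv_apply_subset ℝ (f := partialDeriv ij.2 φ)
      (EuclideanSpace.single ij.1 1)).trans
      (tsupport_fderiv_apply_subset ℝ (f := φ) (EuclideanSpace.single ij.2 1))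
    change partialDeriv ij.1 (partialDeriv ij.2 φ) x = 0
    exact image_eq_zero_of_notMem_tsupport fun hm => hx (h2 hm)
  rw [this, inner_zero_left]

lemma integral_inner_hessian_line (hφ : ContDiff ℝ ∞ φ) (h x : EuclideanSpace ℝ (Fin N)) :
    ∫ t, inner ℝ (hessian φ (x + t • h)) (tensorSquare h) ∂differenceLaw =
      secondDifference φ h x := by
  have h2 : ∀ t : ℝ, HasDerivAt (fun t : ℝ => ∑ j, h j * partialDeriv j φ (x + t • h))
      (inner ℝ (hessian φ (x + t • h)) (tensorSquare h)) t := by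
    intro t
    have hd := HasDerivAt.fun_sum (u := Finset.univ) fun j _ =>
      (hasDerivAt_comp_line (contDiff_partialDeriv hφ j) x h t).const_mul (h j)
    have hs : (inner ℝ (hessian φ (x + t • h)) (tensorSquare h) : ℝ) =
        ∑ j, h j * ∑ i, h i * partialDeriv i (partialDeriv j φ) (x + t • h) := by
      rw [inner_tensorSquare, Finset.sum_comm]
      refine Finset.sum_congr rfl fun j _ => ?_
      rw [Finset.mul_sum]
      refine Finset.sum_congr rfl fun i _ => ?_
      simp only [hessian]
      ring
    rwa [hs]
  have h3 : Continuous fun t : ℝ => (inner ℝ (hessian φ (x + t • h)) (tensorSquare h) : ℝ) :=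
    ((continuous_hessian hφ).comp (by fun_prop : Continuous fun t : ℝ => x + t • h)).inner
      continuous_const
  rw [integral_differenceLaw (hasDerivAt_comp_line hφ x h) h2 h3]
  simp [secondDifference, sub_eq_add_neg]

end Classical

/-! ### Averages along lines and Fubini -/

section Shear

variable {X V : Type*} [NormedAddCommGroup X] [NormedSpace ℝ X] [FiniteDimensional ℝ X]
  [MeasurableSpace X] [BorelSpace X] [NormedAddCommGroup V]
  {μ : Measure X} [μ.IsAddHaarMeasure]

/-- On each fibre `t` the map is a translation. It carries joint measurability and integrability
from `f z.2` to `f (z.2 - z.1 • h)`. -/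
lemma measurePreserving_shear (ν : Measure ℝ) [SFinite ν] (h : X) :
    MeasurePreserving (fun z : ℝ × X => (z.1, z.2 - z.1 • h)) (ν.prod μ) (ν.prod μ) := by
  refine (MeasurePreserving.id ν).skew_product (g := fun t x => x - t • h) (by fun_prop) ?_
  exact Eventually.of_forall fun t => (measurePreserving_sub_right μ (t • h)).map_eq

lemma LocallyIntegrable.comp_add_right {f : X → V} (hf : LocallyIntegrable f μ) (a : X) :
    LocallyIntegrable (fun x => f (x + a)) μ := by
  rw [locallyIntegrable_iff] at hf ⊢
  intro K hK
  have h := ((measurePreserving_add_right μ a).integrableOn_comp_preimage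
    (MeasurableEquiv.addRight a).measurableEmbedding).2 (hf _ (hK.image (continuous_add_const a)))
  rwa [Set.preimage_image_eq _ (add_left_injective a)] at h

/-- Because `|t| ≤ 1` almost surely, only the values of `f` on a ball enlarged by `‖h‖` matter, and
the truncation of `f` to that ball is globally integrable. -/
lemma integrable_mul_comp_line {f : X → ℝ} (hf : LocallyIntegrable f μ) {ψ : X → ℝ}
    (hψ : Continuous ψ) (hψc : HasCompactSupport ψ) (h : X) :
    Integrable (fun z : ℝ × X => f z.2 * ψ (z.2 + z.1 • h)) (differenceLaw.prod μ) := by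
  obtain ⟨R, hR⟩ := hψc.isCompact.isBounded.subset_closedBall (0 : X)
  set K := Metric.closedBall (0 : X) (R + ‖h‖) with hK
  have hfK : Integrable (K.indicator f) μ :=
    (integrable_indicator_iff Metric.isClosed_closedBall.measurableSet).2
      (hf.integrableOn_isCompact (isCompact_closedBall _ _))
  obtain ⟨C, hC⟩ := hψc.exists_bound_of_continuous hψ
  have hψ' : Continuous fun z : ℝ × X => ψ (z.2 + z.1 • h) := by fun_prop
  have hint := (hfK.comp_snd differenceLaw).mul_bdd (c := C) hψ'.aestronglyMeasurable
    (Eventually.of_forall fun z => hC _)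
  refine hint.congr ?_
  have hae : ∀ᵐ z : ℝ × X ∂(differenceLaw.prod μ), |z.1| ≤ 1 :=
    Measure.quasiMeasurePreserving_fst.ae ae_differenceLaw_abs_le_one
  filter_upwards [hae] with z hz
  by_cases hzK : z.2 ∈ K
  · simp [hzK]
  · have : ψ (z.2 + z.1 • h) = 0 := by
      refine image_eq_zero_of_notMem_tsupport fun hm => hzK ?_
      have h1 := hR hm
      rw [mem_closedBall_zero_iff] at h1 ⊢
      calc ‖z.2‖ = ‖(z.2 + z.1 • h) - z.1 • h‖ := by simp
        _ ≤ ‖z.2 + z.1 • h‖ + ‖z.1 • h‖ := norm_sub_le _ _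
        _ ≤ R + ‖h‖ := by
          rw [norm_smul, Real.norm_eq_abs]
          gcongr
          exact mul_le_of_le_one_left (norm_nonneg _) hz
    simp [hzK, this]

lemma integrable_comp_line {f : X → V} (hf : LocallyIntegrable f μ) {K : Set X}
    (hK : IsCompact K) (h : X) :
    Integrable (fun z : ℝ × X => f (z.2 - z.1 • h)) (differenceLaw.prod (μ.restrict K)) := by
  obtain ⟨R, hR⟩ := hK.isBounded.subset_closedBall (0 : X)
  set B := Metric.closedBall (0 : X) (R + ‖h‖)
  have hfB : Integrable (B.indicator f) μ :=
    (integrable_indicator_iff Metric.isClosed_closedBall.measurableSet).2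
      (hf.integrableOn_isCompact (isCompact_closedBall _ _))
  have h1 : Integrable (fun z : ℝ × X => B.indicator f (z.2 - z.1 • h))
      (differenceLaw.prod μ) :=
    (measurePreserving_shear differenceLaw h).integrable_comp_of_integrable
      (hfB.comp_snd differenceLaw)
  have h2 := h1.mono_measure
    (Measure.prod_mono (le_refl differenceLaw) (Measure.restrict_le_self (μ := μ) (s := K)))
  refine h2.congr ?_
  have hae : ∀ᵐ z : ℝ × X ∂(differenceLaw.prod (μ.restrict K)), |z.1| ≤ 1 :=
    Measure.quasiMeasurePreserving_fst.ae ae_differenceLaw_abs_le_one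
  have hae2 : ∀ᵐ z : ℝ × X ∂(differenceLaw.prod (μ.restrict K)), z.2 ∈ K :=
    Measure.quasiMeasurePreserving_snd.ae (ae_restrict_mem hK.measurableSet)
  filter_upwards [hae, hae2] with z hz hzK
  refine Set.indicator_of_mem ?_ _
  have h1 := hR hzK
  rw [mem_closedBall_zero_iff] at h1 ⊢
  calc ‖z.2 - z.1 • h‖ ≤ ‖z.2‖ + ‖z.1 • h‖ := norm_sub_le _ _
    _ ≤ R + ‖h‖ := by
      rw [norm_smul, Real.norm_eq_abs]
      gcongr
      exact mul_le_of_le_one_left (norm_nonneg _) hz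

lemma locallyIntegrable_integral_line [NormedSpace ℝ V] {f : X → V}
    (hf : LocallyIntegrable f μ) (h : X) :
    LocallyIntegrable (fun x => ∫ t, f (x - t • h) ∂differenceLaw) μ := by
  rw [locallyIntegrable_iff]
  exact fun K hK => (integrable_comp_line hf hK h).integral_prod_right

/-- The adjoint of averaging along `-t • h` is averaging along `+t • h`. This is how the sign
differs between the smooth and the weak Taylor formula. -/
lemma integral_mul_integral_line {f : X → ℝ} (hf : LocallyIntegrable f μ) {ψ : X → ℝ}
    (hψ : Continuous ψ) (hψc : HasCompactSupport ψ) (h : X) :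
    ∫ x, ψ x * ∫ t, f (x - t • h) ∂differenceLaw ∂μ =
      ∫ t, ∫ x, f x * ψ (x + t • h) ∂μ ∂differenceLaw := by
  have h1 : Integrable (fun z : ℝ × X => f (z.2 - z.1 • h) * ψ z.2) (differenceLaw.prod μ) := by
    simpa [Function.comp_def] using
      (measurePreserving_shear differenceLaw h).integrable_comp_of_integrable
        (integrable_mul_comp_line hf hψ hψc h)
  have h2 : ∀ t : ℝ, ∫ x, f x * ψ (x + t • h) ∂μ = ∫ x, f (x - t • h) * ψ x ∂μ := by
    intro t
    rw [← integral_sub_right_eq_self _ (t • h)]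
    simp
  simp only [h2]
  rw [integral_integral_swap (f := fun t x => f (x - t • h) * ψ x) h1]
  simp only [integral_mul_const, mul_comm (ψ _)]

end Shear

/-! ### Taylor's formula, uniqueness and symmetry for weak Hessians -/

section WeakHessian

variable {N : ℕ} {u : EuclideanSpace ℝ (Fin N) → ℝ} {D : EuclideanSpace ℝ (Fin N) → Mat N}

lemma locallyIntegrable_inner {f : EuclideanSpace ℝ (Fin N) → Mat N}
    (hf : LocallyIntegrable f volume) (A : Mat N) :
    LocallyIntegrable (fun x => inner ℝ (f x) A) volume := by
  rw [locallyIntegrable_iff] at hf ⊢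
  exact fun K hK => (hf K hK).inner_const A

lemma locallyIntegrable_entry {f : EuclideanSpace ℝ (Fin N) → Mat N}
    (hf : LocallyIntegrable f volume) (ij : Fin N × Fin N) :
    LocallyIntegrable (fun x => f x ij) volume := by
  have h := locallyIntegrable_inner hf (EuclideanSpace.single ij 1)
  simpa [EuclideanSpace.inner_single_right] using h

lemma integrable_mul_of_hasCompactSupport {f ψ : EuclideanSpace ℝ (Fin N) → ℝ}
    (hf : LocallyIntegrable f volume) (hψ : Continuous ψ) (hψc : HasCompactSupport ψ) :
    Integrable (fun x => f x * ψ x) volume := by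
  simpa [mul_comm] using hf.integrable_smul_left_of_hasCompactSupport hψ hψc

lemma IsWeakHessian.integral_inner (hD : IsWeakHessian u D) {φ : EuclideanSpace ℝ (Fin N) → ℝ}
    (hφ : ContDiff ℝ ∞ φ) (hφc : HasCompactSupport φ) (h : EuclideanSpace ℝ (Fin N)) :
    ∫ x, u x * inner ℝ (hessian φ x) (tensorSquare h) =
      ∫ x, inner ℝ (D x) (tensorSquare h) * φ x := by
  simp only [inner_tensorSquare, Finset.mul_sum, Finset.sum_mul]
  have h1 : ∀ i j, Integrable
      (fun x => u x * (hessian φ x (i, j) * (h i * h j))) volume := by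
    intro i j
    have := (integrable_mul_of_hasCompactSupport hD.locallyIntegrable
      (contDiff_partialDeriv (contDiff_partialDeriv hφ j) i).continuous
      (hasCompactSupport_partialDeriv (hasCompactSupport_partialDeriv hφc j) i)).mul_const
        (h i * h j)
    simpa only [hessian, mul_assoc] using this
  have h2 : ∀ i j, Integrable (fun x => D x (i, j) * (h i * h j) * φ x) volume := by
    intro i j
    have := (integrable_mul_of_hasCompactSupport
      (locallyIntegrable_entry hD.locallyIntegrable_hessian (i, j))
      hφ.continuous hφc).mul_const (h i * h j)
    simpa only [mul_right_comm] using this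
  rw [integral_finsetSum _ fun i _ => integrable_finsetSum _ fun j _ => h1 i j,
    integral_finsetSum _ fun i _ => integrable_finsetSum _ fun j _ => h2 i j]
  refine Finset.sum_congr rfl fun i _ => ?_
  rw [integral_finsetSum _ fun j _ => h1 i j, integral_finsetSum _ fun j _ => h2 i j]
  refine Finset.sum_congr rfl fun j _ => ?_
  have := hD.integral_eq i j φ hφ hφc
  simp only [hessian, ← mul_assoc]
  simp only [mul_right_comm _ _ (φ _), integral_mul_const, this]

lemma locallyIntegrable_secondDifference (hu : LocallyIntegrable u volume)
    (h : EuclideanSpace ℝ (Fin N)) : LocallyIntegrable (secondDifference u h) volume := by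
  have h1 := LocallyIntegrable.comp_add_right hu h
  have h2 := LocallyIntegrable.comp_add_right hu (-h)
  simp only [← sub_eq_add_neg] at h2
  exact (h1.sub (hu.smul (2 : ℝ))).add h2

/-- The second difference is symmetric under `h ↦ -h`, hence self-adjoint by translation invariance.
-/
lemma integral_mul_secondDifference (hu : LocallyIntegrable u volume)
    {φ : EuclideanSpace ℝ (Fin N) → ℝ} (hφ : Continuous φ) (hφc : HasCompactSupport φ)
    (h : EuclideanSpace ℝ (Fin N)) :
    ∫ x, φ x * secondDifference u h x = ∫ x, u x * secondDifference φ h x := by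
  have i1 : ∀ a, Integrable (fun x => u (x + a) * φ x) volume := fun a =>
    integrable_mul_of_hasCompactSupport (LocallyIntegrable.comp_add_right hu a) hφ hφc
  have i2 : ∀ a, Integrable (fun x => u x * φ (x + a)) volume := fun a =>
    integrable_mul_of_hasCompactSupport hu (by fun_prop)
      (hφc.comp_homeomorph (Homeomorph.addRight a))
  have e1 : ∀ a, ∫ x, u (x + a) * φ x = ∫ x, u x * φ (x + -a) := by
    intro a
    rw [← integral_add_right_eq_self _ (-a)]
    simp
  calc ∫ x, φ x * secondDifference u h x
      = ∫ x, (u (x + h) * φ x - 2 * (u (x + 0) * φ x) + u (x + -h) * φ x) := by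
        congr 1; ext x; simp only [secondDifference, add_zero, sub_eq_add_neg]; ring
    _ = ∫ x, (u x * φ (x + -h) - 2 * (u x * φ (x + 0)) + u x * φ (x + h)) := by
        rw [integral_add (f := fun x => u (x + h) * φ x - 2 * (u (x + 0) * φ x))
            ((i1 h).sub ((i1 0).const_mul 2)) (i1 (-h)),
          integral_sub (i1 h) ((i1 0).const_mul 2), integral_const_mul,
          integral_add (f := fun x => u x * φ (x + -h) - 2 * (u x * φ (x + 0)))
            ((i2 (-h)).sub ((i2 0).const_mul 2)) (i2 h),
          integral_sub (i2 (-h)) ((i2 0).const_mul 2), integral_const_mul, e1, e1, e1, neg_neg,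
          neg_zero]
    _ = _ := by
        congr 1; ext x; simp only [secondDifference, add_zero, sub_eq_add_neg]; ring

/-- Taylor's formula for the second differences of a function with a weak Hessian. -/
theorem IsWeakHessian.secondDifference_ae_eq (hD : IsWeakHessian u D)
    (h : EuclideanSpace ℝ (Fin N)) :
    ∀ᵐ x, secondDifference u h x =
      ∫ t, inner ℝ (D (x - t • h)) (tensorSquare h) ∂differenceLaw := by
  have hDi := locallyIntegrable_inner hD.locallyIntegrable_hessian (tensorSquare h)
  refine ae_eq_of_integral_contDiff_smul_eq
    (locallyIntegrable_secondDifference hD.locallyIntegrable h)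
    (locallyIntegrable_integral_line hDi h) fun φ hφ hφc => ?_
  simp only [smul_eq_mul]
  have hcH : Continuous fun x => (inner ℝ (hessian φ x) (tensorSquare h) : ℝ) :=
    (continuous_hessian hφ).inner continuous_const
  rw [integral_mul_secondDifference hD.locallyIntegrable hφ.continuous hφc,
    integral_mul_integral_line hDi hφ.continuous hφc]
  calc ∫ x, u x * secondDifference φ h x
      = ∫ x, ∫ t, u x * inner ℝ (hessian φ (x + t • h)) (tensorSquare h) ∂differenceLaw := by
        simp only [integral_const_mul, integral_inner_hessian_line hφ]
    _ = ∫ t, ∫ x, u x * inner ℝ (hessian φ (x + t • h)) (tensorSquare h) ∂volume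
          ∂differenceLaw :=
        (integral_integral_swap (integrable_mul_comp_line hD.locallyIntegrable hcH
          (hasCompactSupport_inner_hessian hφc _) h)).symm
    -- For fixed `t`, the translate of `φ` by `t • h` is again a test function, whose Hessian is the
    -- translated Hessian; the definition of `D` applies to it.
    _ = _ := by
        refine integral_congr_ae (Eventually.of_forall fun t => ?_)
        dsimp only
        have hsh : ContDiff ℝ ∞ fun x => φ (x + t • h) := by fun_prop
        have hshc : HasCompactSupport fun x => φ (x + t • h) :=
          hφc.comp_homeomorph (Homeomorph.addRight (t • h))
        rw [← hD.integral_inner hsh hshc h]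
        have hp : ∀ i (f : EuclideanSpace ℝ (Fin N) → ℝ),
            partialDeriv i (fun x => f (x + t • h)) = fun x => partialDeriv i f (x + t • h) := by
          intro i f
          ext x
          simp only [partialDeriv, fderiv_comp_add_right]
        have : ∀ x, hessian (fun x => φ (x + t • h)) x = hessian φ (x + t • h) := by
          intro x
          simp only [hessian, hp]
        simp only [this]

lemma IsWeakHessian.ae_eq {D' : EuclideanSpace ℝ (Fin N) → Mat N} (hD : IsWeakHessian u D)
    (hD' : IsWeakHessian u D') : D =ᵐ[volume] D' := by
  have : ∀ ij : Fin N × Fin N, ∀ᵐ x, D x ij = D' x ij := by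
    intro ij
    refine ae_eq_of_integral_contDiff_smul_eq
      (locallyIntegrable_entry hD.locallyIntegrable_hessian ij)
      (locallyIntegrable_entry hD'.locallyIntegrable_hessian ij) fun φ hφ hφc => ?_
    simp only [smul_eq_mul, mul_comm (φ _)]
    rw [← hD.integral_eq ij.1 ij.2 φ hφ hφc, ← hD'.integral_eq ij.1 ij.2 φ hφ hφc]
  filter_upwards [ae_all_iff.2 this] with x hx
  ext ij
  exact hx ij

/-- Inherited from equality of mixed partials of the test functions. -/
lemma IsWeakHessian.ae_symmetric (hD : IsWeakHessian u D) :
    ∀ᵐ x, ∀ i j, D x (i, j) = D x (j, i) := by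
  refine ae_all_iff.2 fun i => ae_all_iff.2 fun j => ?_
  refine ae_eq_of_integral_contDiff_smul_eq
    (locallyIntegrable_entry hD.locallyIntegrable_hessian _)
    (locallyIntegrable_entry hD.locallyIntegrable_hessian _) fun φ hφ hφc => ?_
  simp only [smul_eq_mul, mul_comm (φ _)]
  rw [← hD.integral_eq i j φ hφ hφc, ← hD.integral_eq j i φ hφ hφc]
  simp only [partialDeriv_comm hφ i j]

end WeakHessian

/-! ### Pointwise bounds on the kernel -/

section Kernel

variable {N : ℕ}

lemma measurable_kernelMatrix :
    Measurable (kernelMatrix : EuclideanSpace ℝ (Fin N) → Mat N) := by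
  unfold kernelMatrix
  refine (WithLp.measurable_toLp 2 _).comp (measurable_pi_iff.2 fun ij => ?_)
  fun_prop

lemma norm_normalize_le_one (h : EuclideanSpace ℝ (Fin N)) : ‖‖h‖⁻¹ • h‖ ≤ 1 := by
  rw [norm_smul, norm_inv, norm_norm]
  exact inv_mul_le_one

lemma sum_normalize_mul_self {h : EuclideanSpace ℝ (Fin N)} (hh : h ≠ 0) :
    ∑ i, (‖h‖⁻¹ • h) i * (‖h‖⁻¹ • h) i = 1 := by
  have h2 := EuclideanSpace.real_norm_sq_eq (‖h‖⁻¹ • h)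
  rw [norm_smul, norm_inv, norm_norm, inv_mul_cancel₀ (norm_ne_zero_iff.2 hh)] at h2
  simpa only [sq, mul_one] using h2.symm

lemma kernelMatrix_apply {h : EuclideanSpace ℝ (Fin N)} (hh : h ≠ 0) (i j : Fin N) :
    kernelMatrix h (i, j) = (‖h‖⁻¹ • h) i * (‖h‖⁻¹ • h) j -
      (if i = j then 1 else 0) / ((N : ℝ) + 2) := by
  have : ‖h‖ ≠ 0 := norm_ne_zero_iff.2 hh
  have : (N : ℝ) + 2 ≠ 0 := by positivity
  simp only [kernelMatrix, PiLp.smul_apply, smul_eq_mul]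
  field_simp

lemma inner_tensorSquare_div (A : Mat N) (h : EuclideanSpace ℝ (Fin N)) :
    inner ℝ A (tensorSquare h) / ‖h‖ ^ 2 =
      ∑ k, ∑ l, A (k, l) * ((‖h‖⁻¹ • h) k * (‖h‖⁻¹ • h) l) := by
  rw [inner_tensorSquare, Finset.sum_div]
  refine Finset.sum_congr rfl fun k _ => ?_
  rw [Finset.sum_div]
  refine Finset.sum_congr rfl fun l _ => ?_
  simp only [PiLp.smul_apply, smul_eq_mul, div_eq_mul_inv]
  ring

lemma abs_inner_tensorSquare_div_le (A : Mat N) (h : EuclideanSpace ℝ (Fin N)) :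
    |inner ℝ A (tensorSquare h) / ‖h‖ ^ 2| ≤ ‖A‖ := by
  rw [abs_div, abs_of_nonneg (sq_nonneg ‖h‖)]
  refine div_le_of_le_mul₀ (by positivity) (norm_nonneg _) ?_
  rw [← norm_tensorSquare]
  exact abs_real_inner_le_norm _ _

lemma exists_norm_kernelMatrix_le (N : ℕ) :
    ∃ C : ℝ, ∀ h : EuclideanSpace ℝ (Fin N), ‖kernelMatrix h‖ ≤ C := by
  set J : Mat N := WithLp.toLp 2 fun ij => (if ij.1 = ij.2 then 1 else 0) / ((N : ℝ) + 2)
  refine ⟨1 + ‖J‖, fun h => ?_⟩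
  -- At `h = 0` division by zero makes the kernel vanish; elsewhere it is the tensor square of a
  -- vector of norm one minus the fixed matrix `J`.
  rcases eq_or_ne h 0 with rfl | hh
  · have : kernelMatrix (0 : EuclideanSpace ℝ (Fin N)) = 0 := by
      ext ij
      simp [kernelMatrix]
    rw [this, norm_zero]
    positivity
  · have : kernelMatrix h = tensorSquare (‖h‖⁻¹ • h) - J := by
      ext ij
      exact kernelMatrix_apply hh ij.1 ij.2
    rw [this]
    refine (norm_sub_le _ _).trans ?_
    gcongr
    rw [norm_tensorSquare]
    exact pow_le_one₀ (norm_nonneg _) (norm_normalize_le_one h)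

end Kernel

/-! ### Fourth moments of a radial direction and the reproducing identity -/

section Moments

variable {N : ℕ} {ρ : EuclideanSpace ℝ (Fin N) → ℝ}

lemma integrable_mul_inner_normalize (hint : Integrable ρ volume)
    (a b c d : EuclideanSpace ℝ (Fin N)) :
    Integrable (fun h => ρ h * (inner ℝ (‖h‖⁻¹ • h) a * inner ℝ (‖h‖⁻¹ • h) b *
      inner ℝ (‖h‖⁻¹ • h) c * inner ℝ (‖h‖⁻¹ • h) d)) volume := by
  refine hint.mul_bdd (c := ‖a‖ * ‖b‖ * ‖c‖ * ‖d‖) ?_ (Eventually.of_forall fun h => ?_)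
  · exact Measurable.aestronglyMeasurable (by fun_prop)
  · have key : ∀ v, ‖(inner ℝ (‖h‖⁻¹ • h) v : ℝ)‖ ≤ ‖v‖ := fun v =>
      (norm_inner_le_norm _ _).trans
        (mul_le_of_le_one_left (norm_nonneg v) (norm_normalize_le_one h))
    simp only [norm_mul]
    gcongr <;> exact key _

lemma integrable_mul_normalize (hint : Integrable ρ volume) (i j k l : Fin N) :
    Integrable (fun h => ρ h *
      ((‖h‖⁻¹ • h) i * (‖h‖⁻¹ • h) j * (‖h‖⁻¹ • h) k * (‖h‖⁻¹ • h) l)) volume := by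
  simpa [EuclideanSpace.inner_single_right] using
    integrable_mul_inner_normalize hint (EuclideanSpace.single i 1) (EuclideanSpace.single j 1)
      (EuclideanSpace.single k 1) (EuclideanSpace.single l 1)

/-- Reflections preserve Lebesgue measure and `ρ`, so the integral depends only on `‖v‖`;
homogeneity of degree four fixes the form. -/
lemma exists_integral_mul_inner_normalize_pow (hrad : ∀ x y, ‖x‖ = ‖y‖ → ρ x = ρ y) :
    ∃ c : ℝ, ∀ v : EuclideanSpace ℝ (Fin N),
      ∫ h, ρ h * (inner ℝ (‖h‖⁻¹ • h) v) ^ 4 = c * ‖v‖ ^ 4 := by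
  have inv : ∀ v w : EuclideanSpace ℝ (Fin N), ‖v‖ = ‖w‖ →
      ∫ h, ρ h * (inner ℝ (‖h‖⁻¹ • h) v) ^ 4 = ∫ h, ρ h * (inner ℝ (‖h‖⁻¹ • h) w) ^ 4 := by
    intro v w hvw
    -- Vectors of equal norm are exchanged by the reflection in the hyperplane orthogonal to their
    -- difference.
    set R := (ℝ ∙ (v - w))ᗮ.reflection
    have hR : R v = w := Submodule.reflection_sub hvw
    rw [← (R.measurePreserving).integral_comp R.toHomeomorph.measurableEmbedding
      (fun h => ρ h * (inner ℝ (‖h‖⁻¹ • h) w) ^ 4)]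
    congr 1
    ext h
    rw [hrad (R h) h (R.norm_map h), R.norm_map, ← hR, ← map_smul, R.inner_map_map]
  rcases subsingleton_or_nontrivial (EuclideanSpace ℝ (Fin N)) with hs | hn
  · refine ⟨0, fun v => ?_⟩
    simp [Subsingleton.elim v 0]
  · obtain ⟨e, he⟩ := exists_norm_eq (EuclideanSpace ℝ (Fin N)) zero_le_one
    refine ⟨∫ h, ρ h * (inner ℝ (‖h‖⁻¹ • h) e) ^ 4, fun v => ?_⟩
    rw [inv v (‖v‖ • e) (by simp [norm_smul, he]), ← integral_mul_const]
    congr 1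
    ext h
    rw [inner_smul_right]
    ring

lemma exists_integral_mul_inner_normalize (hrad : ∀ x y, ‖x‖ = ‖y‖ → ρ x = ρ y)
    (hint : Integrable ρ volume) :
    ∃ c : ℝ, ∀ v₁ v₂ v₃ v₄ : EuclideanSpace ℝ (Fin N),
      ∫ h, ρ h * (inner ℝ (‖h‖⁻¹ • h) v₁ * inner ℝ (‖h‖⁻¹ • h) v₂ *
        inner ℝ (‖h‖⁻¹ • h) v₃ * inner ℝ (‖h‖⁻¹ • h) v₄) =
      c * (inner ℝ v₁ v₂ * inner ℝ v₃ v₄ + inner ℝ v₁ v₃ * inner ℝ v₂ v₄ +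
        inner ℝ v₁ v₄ * inner ℝ v₂ v₃) := by
  obtain ⟨c, hc⟩ := exists_integral_mul_inner_normalize_pow hrad
  -- With all four vectors equal, the three pairings coincide; hence the factor `1/3`.
  refine ⟨c / 3, fun v₁ v₂ v₃ v₄ => ?_⟩
  have hi : ∀ v : EuclideanSpace ℝ (Fin N),
      Integrable (fun h => ρ h * (inner ℝ (‖h‖⁻¹ • h) v) ^ 4) volume := by
    intro v
    refine (integrable_mul_inner_normalize hint v v v v).congr (Eventually.of_forall fun h => ?_)
    ring
  -- polarization over the signs of `v₂`, `v₃`, `v₄`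
  let σ : Fin 2 → ℝ := ![1, -1]
  let V : Fin 2 → Fin 2 → Fin 2 → EuclideanSpace ℝ (Fin N) :=
    fun i j k => v₁ + σ i • v₂ + σ j • v₃ + σ k • v₄
  -- The signed sum kills every monomial except `x₁x₂x₃x₄`, which has coefficient `24` in each of
  -- the `8` fourth powers; `192 = 8 · 24`.
  have hpol : ∀ h : EuclideanSpace ℝ (Fin N),
      ρ h * (inner ℝ (‖h‖⁻¹ • h) v₁ * inner ℝ (‖h‖⁻¹ • h) v₂ *
        inner ℝ (‖h‖⁻¹ • h) v₃ * inner ℝ (‖h‖⁻¹ • h) v₄) =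
      ∑ i, ∑ j, ∑ k, (σ i * σ j * σ k / 192) * (ρ h * (inner ℝ (‖h‖⁻¹ • h) (V i j k)) ^ 4) := by
    intro h
    simp only [V, σ, inner_add_right, inner_smul_right, Fin.sum_univ_two, Matrix.cons_val_zero,
      Matrix.cons_val_one]
    ring
  simp only [hpol]
  rw [integral_finsetSum _ fun i _ => integrable_finsetSum _ fun j _ =>
    integrable_finsetSum _ fun k _ => (hi _).const_mul _]
  simp only [fun i => integral_finsetSum Finset.univ fun j _ =>
    integrable_finsetSum Finset.univ fun k _ => (hi (V i j k)).const_mul (σ i * σ j * σ k / 192),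
    fun i j => integral_finsetSum Finset.univ fun k _ =>
      (hi (V i j k)).const_mul (σ i * σ j * σ k / 192),
    integral_const_mul, hc]
  have hn : ∀ v : EuclideanSpace ℝ (Fin N), ‖v‖ ^ 4 = (inner ℝ v v) ^ 2 := by
    intro v
    rw [real_inner_self_eq_norm_sq]
    ring
  simp only [hn, V, σ, inner_add_right, inner_add_left, inner_smul_right, real_inner_smul_left,
    Fin.sum_univ_two, Matrix.cons_val_zero, Matrix.cons_val_one, real_inner_comm v₁ v₂,
    real_inner_comm v₁ v₃, real_inner_comm v₁ v₄, real_inner_comm v₂ v₃, real_inner_comm v₂ v₄,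
    real_inner_comm v₃ v₄]
  ring

/-- The fourth moments of the direction `h / ‖h‖` with respect to a radial probability density. -/
lemma integral_mul_normalize (hN : 0 < N) (hrad : ∀ x y, ‖x‖ = ‖y‖ → ρ x = ρ y)
    (hint : Integrable ρ volume) (hone : ∫ h, ρ h = 1) (i j k l : Fin N) :
    ∫ h, ρ h * ((‖h‖⁻¹ • h) i * (‖h‖⁻¹ • h) j * (‖h‖⁻¹ • h) k * (‖h‖⁻¹ • h) l) =
      ((N : ℝ) * (N + 2))⁻¹ * ((if i = j then 1 else 0) * (if k = l then 1 else 0) +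
        (if i = k then 1 else 0) * (if j = l then 1 else 0) +
        (if i = l then 1 else 0) * (if j = k then 1 else 0)) := by
  obtain ⟨c, hc⟩ := exists_integral_mul_inner_normalize hrad hint
  have : Nonempty (Fin N) := ⟨⟨0, hN⟩⟩
  have hM : ∀ i j k l : Fin N,
      ∫ h, ρ h * ((‖h‖⁻¹ • h) i * (‖h‖⁻¹ • h) j * (‖h‖⁻¹ • h) k * (‖h‖⁻¹ • h) l) =
      c * ((if i = j then 1 else 0) * (if k = l then 1 else 0) +
        (if i = k then 1 else 0) * (if j = l then 1 else 0) +
        (if i = l then 1 else 0) * (if j = k then 1 else 0)) := by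
    intro i j k l
    simpa [EuclideanSpace.inner_single_right, EuclideanSpace.inner_single_left, Pi.single_apply,
      eq_comm] using hc (EuclideanSpace.single i 1) (EuclideanSpace.single j 1)
        (EuclideanSpace.single k 1) (EuclideanSpace.single l 1)
  have hiM := integrable_mul_normalize hint
  -- Normalization: contracting both index pairs uses `|ω|² = 1` and yields `c (N² + 2N) = 1`.
  have hsum : ∑ i : Fin N, ∑ k : Fin N,
      ∫ h, ρ h * ((‖h‖⁻¹ • h) i * (‖h‖⁻¹ • h) i * (‖h‖⁻¹ • h) k * (‖h‖⁻¹ • h) k) = 1 := by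
    simp only [← integral_finsetSum _ fun k _ => hiM _ _ k k]
    rw [← integral_finsetSum _ fun i _ => integrable_finsetSum _ fun k _ => hiM i i k k, ← hone]
    refine integral_congr_ae ?_
    filter_upwards [(Measure.ae_ne volume (0 : EuclideanSpace ℝ (Fin N)))] with h hh
    have hn := sum_normalize_mul_self hh
    calc _ = ρ h * ((∑ i, (‖h‖⁻¹ • h) i * (‖h‖⁻¹ • h) i) *
          ∑ k, (‖h‖⁻¹ • h) k * (‖h‖⁻¹ • h) k) := by
          simp only [Finset.sum_mul_sum]
          simp only [Finset.mul_sum, mul_assoc]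
      _ = ρ h := by rw [hn]; ring
  simp only [hM, if_true, ← Finset.mul_sum, Finset.sum_add_distrib, ← ite_and, and_self,
    mul_ite, mul_one, mul_zero, Finset.sum_ite_eq, Finset.mem_univ, Finset.sum_const,
    Finset.card_univ, Fintype.card_fin, nsmul_eq_mul] at hsum
  have hc' : c = ((N : ℝ) * (N + 2))⁻¹ := by
    refine eq_inv_of_mul_eq_one_left ?_
    linear_combination hsum
  rw [hM, hc']

lemma integrable_mul_inner_smul_kernelMatrix (hint : Integrable ρ volume) (A : Mat N) :
    Integrable (fun h => (ρ h * (inner ℝ A (tensorSquare h) / ‖h‖ ^ 2)) • kernelMatrix h)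
      volume := by
  obtain ⟨C, hC⟩ := exists_norm_kernelMatrix_le N
  have hm : Measurable fun h : EuclideanSpace ℝ (Fin N) =>
      (inner ℝ A (tensorSquare h) / ‖h‖ ^ 2 : ℝ) := by
    have := (continuous_tensorSquare (N := N)).measurable
    fun_prop
  exact (hint.mul_bdd (c := ‖A‖) hm.aestronglyMeasurable
    (Eventually.of_forall fun h => abs_inner_tensorSquare_div_le A h)).smul_bdd C
      measurable_kernelMatrix.aestronglyMeasurable (Eventually.of_forall hC)

/-- The trace-corrected kernel reproduces symmetric matrices. -/
theorem integral_mul_inner_smul_kernelMatrix (hN : 0 < N)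
    (hrad : ∀ x y, ‖x‖ = ‖y‖ → ρ x = ρ y) (hint : Integrable ρ volume) (hone : ∫ h, ρ h = 1)
    {A : Mat N} (hA : ∀ i j, A (i, j) = A (j, i)) :
    ((N : ℝ) * (N + 2) / 2) •
      ∫ h, (ρ h * (inner ℝ A (tensorSquare h) / ‖h‖ ^ 2)) • kernelMatrix h = A := by
  have : Nonempty (Fin N) := ⟨⟨0, hN⟩⟩
  have hN' : (N : ℝ) ≠ 0 := by positivity
  have hN2 : (N : ℝ) + 2 ≠ 0 := by positivity
  have hM := integral_mul_normalize hN hrad hint hone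
  have hiM := integrable_mul_normalize hint
  ext ij
  obtain ⟨i, j⟩ := ij
  have hproj := (EuclideanSpace.proj (𝕜 := ℝ) (i, j)).integral_comp_comm
    (integrable_mul_inner_smul_kernelMatrix hint A)
  simp only [PiLp.proj_apply, PiLp.smul_apply, smul_eq_mul] at hproj ⊢
  rw [← hproj]
  -- The trace correction is only quadratic in `ω`; inserting `∑ₘ ωₘ² = 1` makes it quartic, so the
  -- fourth-moment formula covers every term.
  have hexp : ∀ᵐ h : EuclideanSpace ℝ (Fin N),
      ρ h * (inner ℝ A (tensorSquare h) / ‖h‖ ^ 2) * kernelMatrix h (i, j) =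
      ∑ k, ∑ l, (A (k, l) * (ρ h *
          ((‖h‖⁻¹ • h) k * (‖h‖⁻¹ • h) l * (‖h‖⁻¹ • h) i * (‖h‖⁻¹ • h) j)) -
        ∑ m, A (k, l) * ((if i = j then 1 else 0) / ((N : ℝ) + 2)) * (ρ h *
          ((‖h‖⁻¹ • h) k * (‖h‖⁻¹ • h) l * (‖h‖⁻¹ • h) m * (‖h‖⁻¹ • h) m))) := by
    filter_upwards [(Measure.ae_ne volume (0 : EuclideanSpace ℝ (Fin N)))] with h hh
    have hn := sum_normalize_mul_self hh
    rw [inner_tensorSquare_div, kernelMatrix_apply hh, Finset.mul_sum, Finset.sum_mul]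
    refine Finset.sum_congr rfl fun k _ => ?_
    rw [Finset.mul_sum, Finset.sum_mul]
    refine Finset.sum_congr rfl fun l _ => ?_
    have hm : ∑ m, A (k, l) * ((if i = j then 1 else 0) / ((N : ℝ) + 2)) * (ρ h *
          ((‖h‖⁻¹ • h) k * (‖h‖⁻¹ • h) l * (‖h‖⁻¹ • h) m * (‖h‖⁻¹ • h) m)) =
        A (k, l) * ((if i = j then 1 else 0) / ((N : ℝ) + 2)) * (ρ h *
          ((‖h‖⁻¹ • h) k * (‖h‖⁻¹ • h) l)) * ∑ m, (‖h‖⁻¹ • h) m * (‖h‖⁻¹ • h) m := by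
      rw [Finset.mul_sum]
      exact Finset.sum_congr rfl fun m _ => by ring
    rw [hm, hn]
    ring
  rw [integral_congr_ae hexp]
  have i1 : ∀ k l : Fin N, Integrable (fun h : EuclideanSpace ℝ (Fin N) =>
      A (k, l) * (ρ h *
          ((‖h‖⁻¹ • h) k * (‖h‖⁻¹ • h) l * (‖h‖⁻¹ • h) i * (‖h‖⁻¹ • h) j))) volume :=
    fun k l => (hiM k l i j).const_mul _
  have i2 : ∀ k l m : Fin N, Integrable (fun h : EuclideanSpace ℝ (Fin N) =>
      A (k, l) * ((if i = j then 1 else 0) / ((N : ℝ) + 2)) * (ρ h *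
          ((‖h‖⁻¹ • h) k * (‖h‖⁻¹ • h) l * (‖h‖⁻¹ • h) m * (‖h‖⁻¹ • h) m))) volume :=
    fun k l m => (hiM k l m m).const_mul _
  have i3 : ∀ k l : Fin N, Integrable (fun h : EuclideanSpace ℝ (Fin N) =>
      ∑ m, A (k, l) * ((if i = j then 1 else 0) / ((N : ℝ) + 2)) * (ρ h *
          ((‖h‖⁻¹ • h) k * (‖h‖⁻¹ • h) l * (‖h‖⁻¹ • h) m * (‖h‖⁻¹ • h) m))) volume :=
    fun k l => integrable_finsetSum _ fun m _ => i2 k l m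
  have i4 : ∀ k l : Fin N, Integrable (fun h : EuclideanSpace ℝ (Fin N) =>
      A (k, l) * (ρ h *
          ((‖h‖⁻¹ • h) k * (‖h‖⁻¹ • h) l * (‖h‖⁻¹ • h) i * (‖h‖⁻¹ • h) j)) -
        ∑ m, A (k, l) * ((if i = j then 1 else 0) / ((N : ℝ) + 2)) * (ρ h *
          ((‖h‖⁻¹ • h) k * (‖h‖⁻¹ • h) l * (‖h‖⁻¹ • h) m * (‖h‖⁻¹ • h) m))) volume :=
    fun k l => (i1 k l).sub (i3 k l)
  rw [integral_finsetSum _ fun k _ => integrable_finsetSum _ fun l _ => i4 k l]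
  have hterm : ∀ k, ∫ h : EuclideanSpace ℝ (Fin N), ∑ l, (A (k, l) * (ρ h *
          ((‖h‖⁻¹ • h) k * (‖h‖⁻¹ • h) l * (‖h‖⁻¹ • h) i * (‖h‖⁻¹ • h) j)) -
        ∑ m, A (k, l) * ((if i = j then 1 else 0) / ((N : ℝ) + 2)) * (ρ h *
          ((‖h‖⁻¹ • h) k * (‖h‖⁻¹ • h) l * (‖h‖⁻¹ • h) m * (‖h‖⁻¹ • h) m))) =
      ∑ l, ((N : ℝ) * (N + 2))⁻¹ * (A (k, l) * ((if k = i then 1 else 0) *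
          (if l = j then 1 else 0)) + A (k, l) * ((if k = j then 1 else 0) *
          (if l = i then 1 else 0))) := by
    intro k
    rw [integral_finsetSum _ fun l _ => i4 k l]
    refine Finset.sum_congr rfl fun l _ => ?_
    rw [integral_sub (i1 k l) (i3 k l), integral_finsetSum _ fun m _ => i2 k l m]
    simp only [integral_const_mul, hM, if_true]
    -- The contraction over `m` produces `N + 2`, which cancels the denominator in the kernel; the
    -- result is exactly the trace part of the fourth moment, leaving only `A (i, j) + A (j, i)`.
    have hs : ∑ m : Fin N, A (k, l) * ((if i = j then 1 else 0) / ((N : ℝ) + 2)) *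
        (((N : ℝ) * (N + 2))⁻¹ * ((if k = l then 1 else 0) * 1 +
          (if k = m then 1 else 0) * (if l = m then 1 else 0) +
          (if k = m then 1 else 0) * (if l = m then 1 else 0))) =
        A (k, l) * ((if i = j then 1 else 0) / ((N : ℝ) + 2)) * (((N : ℝ) * (N + 2))⁻¹ *
          ((N + 2) * (if k = l then 1 else 0))) := by
      rw [← Finset.mul_sum, ← Finset.mul_sum, Finset.sum_add_distrib, Finset.sum_add_distrib]
      by_cases hkl : k = l
      · subst hkl
        simp
        left; left
        ring
      · simp [hkl]
    rw [hs]
    field_simp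
    ring
  rw [Finset.sum_congr rfl fun k _ => hterm k]
  simp only [← Finset.mul_sum, Finset.sum_add_distrib]
  simp
  rw [hA j i]
  field_simp
  ring

end Moments

/-! ### The translation modulus and the Taylor remainder -/

section TranslationModulus

variable {N : ℕ} {u : EuclideanSpace ℝ (Fin N) → ℝ} {D : EuclideanSpace ℝ (Fin N) → Mat N}

/-- The `q`-th powers of the `L^q` distances between `D` and its translates by `t • h`, averaged
over `t`. -/
def translationModulus (q : ℝ) (D : EuclideanSpace ℝ (Fin N) → Mat N)
    (h : EuclideanSpace ℝ (Fin N)) : ℝ≥0∞ :=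
  ∫⁻ t, ∫⁻ x, ‖D (x - t • h) - D x‖ₑ ^ q ∂volume ∂differenceLaw

lemma lintegral_translate_sub {p : ℝ≥0∞} (hp1 : 1 ≤ p) (hp : p ≠ ⊤)
    (s : EuclideanSpace ℝ (Fin N)) :
    ∫⁻ x, ‖D (x - s) - D x‖ₑ ^ p.toReal =
      eLpNorm (fun x => D (-s + x) - D x) p volume ^ p.toReal := by
  rw [eLpNorm_rpow_toReal (zero_lt_one.trans_le hp1).ne' hp]
  simp only [neg_add_eq_sub]

lemma exists_translationModulus_le {p : ℝ≥0∞} (hp1 : 1 ≤ p) (hp : p ≠ ⊤)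
    (hD : MemLp D p volume) :
    ∃ B : ℝ≥0∞, B ≠ ⊤ ∧ ∀ h, translationModulus p.toReal D h ≤ B := by
  refine ⟨(eLpNorm D p volume + eLpNorm D p volume) ^ p.toReal,
    ENNReal.rpow_ne_top_of_nonneg ENNReal.toReal_nonneg
      (ENNReal.add_ne_top.2 ⟨hD.eLpNorm_ne_top, hD.eLpNorm_ne_top⟩), fun h => ?_⟩
  refine (lintegral_mono (g := fun _ => (eLpNorm D p volume + eLpNorm D p volume) ^ p.toReal)
    fun t => ?_).trans (by simp)
  dsimp only
  rw [lintegral_translate_sub hp1 hp]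
  have hmp := measurePreserving_add_left (volume : Measure (EuclideanSpace ℝ (Fin N))) (-(t • h))
  gcongr
  calc _ ≤ eLpNorm (fun x => D (-(t • h) + x)) p volume + eLpNorm D p volume :=
        eLpNorm_sub_le (hD.1.comp_measurePreserving hmp) hD.1 hp1
    _ = _ := by
        congr 1
        exact eLpNorm_comp_measurePreserving hD.1 hmp

lemma tendsto_translationModulus {p : ℝ≥0∞} (hp1 : 1 ≤ p) (hp : p ≠ ⊤)
    (hD : MemLp D p volume) :
    Tendsto (translationModulus p.toReal D) (𝓝 0) (𝓝 0) := by
  have hq : 0 < p.toReal := ENNReal.toReal_pos (zero_lt_one.trans_le hp1).ne' hp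
  have h1 : Tendsto (fun s => ∫⁻ x, ‖D (x - s) - D x‖ₑ ^ p.toReal) (𝓝 0) (𝓝 0) := by
    simp only [lintegral_translate_sub hp1 hp]
    have h2 := (tendsto_eLpNorm_comp_add_sub hp1 hp hD).comp
      (continuous_neg.tendsto' (0 : EuclideanSpace ℝ (Fin N)) 0 neg_zero)
    have h3 := (ENNReal.continuous_rpow_const (y := p.toReal)).tendsto' (0 : ℝ≥0∞) 0
      (ENNReal.zero_rpow_of_pos hq)
    exact h3.comp h2
  rw [ENNReal.tendsto_nhds_zero] at h1 ⊢
  intro ε hε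
  obtain ⟨δ, hδ, hb⟩ := Metric.eventually_nhds_iff_ball.1 (h1 ε hε)
  filter_upwards [Metric.ball_mem_nhds 0 hδ] with h hh
  refine (lintegral_mono_ae (g := fun _ => ε) ?_).trans (by simp)
  filter_upwards [ae_differenceLaw_abs_le_one] with t ht
  refine hb _ ?_
  rw [mem_ball_zero_iff] at hh ⊢
  rw [norm_smul, Real.norm_eq_abs]
  exact (mul_le_of_le_one_left (norm_nonneg _) ht).trans_lt hh

/-- Fubini gives this on each compact ball; countably many balls exhaust the space. -/
lemma ae_integrable_line {X V : Type*} [NormedAddCommGroup X] [NormedSpace ℝ X]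
    [FiniteDimensional ℝ X] [MeasurableSpace X] [BorelSpace X] [NormedAddCommGroup V]
    {μ : Measure X} [μ.IsAddHaarMeasure] {f : X → V} (hf : LocallyIntegrable f μ) (h : X) :
    ∀ᵐ x ∂μ, Integrable (fun t : ℝ => f (x - t • h)) differenceLaw := by
  have : ∀ n : ℕ, ∀ᵐ x ∂μ, x ∈ Metric.closedBall (0 : X) n →
      Integrable (fun t : ℝ => f (x - t • h)) differenceLaw := fun n =>
    (ae_restrict_iff' Metric.isClosed_closedBall.measurableSet).1
      (integrable_comp_line hf (isCompact_closedBall _ _) h).prod_left_ae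
  filter_upwards [ae_all_iff.2 this] with x hx
  obtain ⟨n, hn⟩ := exists_nat_ge ‖x‖
  exact hx n (by simpa using hn)

lemma IsWeakHessian.lintegral_secondDifference_sub_le (hu : IsWeakHessian u D) {q : ℝ}
    (hq : 1 ≤ q) (h : EuclideanSpace ℝ (Fin N)) :
    ∫⁻ x, ‖secondDifference u h x - inner ℝ (D x) (tensorSquare h)‖ₑ ^ q ≤
      (‖h‖ₑ ^ 2) ^ q * translationModulus q D h := by
  have hDm := hu.locallyIntegrable_hessian.aestronglyMeasurable
  have hm : AEStronglyMeasurable (fun z : ℝ × EuclideanSpace ℝ (Fin N) =>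
      D (z.2 - z.1 • h) - D z.2) (differenceLaw.prod volume) :=
    (hDm.comp_snd.comp_measurePreserving (measurePreserving_shear differenceLaw h)).sub
      hDm.comp_snd
  have hT : ‖tensorSquare h‖ₑ = ‖h‖ₑ ^ 2 := by
    rw [← ofReal_norm, norm_tensorSquare, ENNReal.ofReal_pow (norm_nonneg _), ofReal_norm]
  have hpt : ∀ᵐ x, ‖secondDifference u h x - inner ℝ (D x) (tensorSquare h)‖ₑ ≤
      ‖h‖ₑ ^ 2 * ∫⁻ t, ‖D (x - t • h) - D x‖ₑ ∂differenceLaw := by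
    filter_upwards [hu.secondDifference_ae_eq h,
      ae_integrable_line hu.locallyIntegrable_hessian h] with x hx hint
    -- As `differenceLaw` has mass one, the frozen term equals its own average and goes under the
    -- integral.
    have h1 : secondDifference u h x - inner ℝ (D x) (tensorSquare h) =
        ∫ t, inner ℝ (D (x - t • h) - D x) (tensorSquare h) ∂differenceLaw := by
      simp only [inner_sub_left]
      rw [integral_sub (hint.inner_const _) (integrable_const _), hx]
      simp
    rw [h1, ← lintegral_const_mul' _ _ (by finiteness)]
    refine (enorm_integral_le_lintegral_enorm _).trans (lintegral_mono fun t => ?_)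
    rw [← hT, mul_comm]
    simpa only [← ofReal_norm, ← ENNReal.ofReal_mul (norm_nonneg _)] using
      ENNReal.ofReal_le_ofReal (norm_inner_le_norm (𝕜 := ℝ) (D (x - t • h) - D x) (tensorSquare h))
  calc ∫⁻ x, ‖secondDifference u h x - inner ℝ (D x) (tensorSquare h)‖ₑ ^ q
      ≤ ∫⁻ x, (‖h‖ₑ ^ 2) ^ q * (∫⁻ t, ‖D (x - t • h) - D x‖ₑ ∂differenceLaw) ^ q := by
        refine lintegral_mono_ae ?_
        filter_upwards [hpt] with x hx
        rw [← ENNReal.mul_rpow_of_nonneg _ _ (by positivity)]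
        gcongr
    _ = (‖h‖ₑ ^ 2) ^ q * ∫⁻ x, (∫⁻ t, ‖D (x - t • h) - D x‖ₑ ∂differenceLaw) ^ q :=
        lintegral_const_mul' _ _ (ENNReal.rpow_ne_top_of_nonneg (by positivity) (by finiteness))
    _ ≤ _ := by
        gcongr
        exact lintegral_rpow_lintegral_le (F := fun t x => ‖D (x - t • h) - D x‖ₑ) hm.enorm hq

end TranslationModulus

/-! ### Concentrating probability measures -/

lemma tendsto_lintegral_of_concentrating {X : Type*} [NormedAddCommGroup X] [MeasurableSpace X]
    [OpensMeasurableSpace X] {ν : ℕ → Measure X} [∀ n, IsProbabilityMeasure (ν n)]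
    (hν : ∀ γ : ℝ, 0 < γ → Tendsto (fun n => ν n {x | γ < ‖x‖}) atTop (𝓝 0))
    {W : X → ℝ≥0∞} {B : ℝ≥0∞} (hB : B ≠ ⊤) (hWB : ∀ x, W x ≤ B) (hW : Tendsto W (𝓝 0) (𝓝 0)) :
    Tendsto (fun n => ∫⁻ x, W x ∂(ν n)) atTop (𝓝 0) := by
  rw [ENNReal.tendsto_nhds_zero] at hW ⊢
  intro ε hε
  have hε2 : 0 < ε / 2 := ENNReal.half_pos hε.ne'
  obtain ⟨δ, hδ, hb⟩ := Metric.eventually_nhds_iff_ball.1 (hW _ hε2)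
  have hms : MeasurableSet {x : X | δ / 2 < ‖x‖} :=
    measurableSet_lt measurable_const continuous_norm.measurable
  -- The radius `δ / 2` ensures that points outside the tail lie in the open ball of radius `δ`.
  have htail := ENNReal.Tendsto.const_mul (a := B) (hν (δ / 2) (half_pos hδ)) (Or.inr hB)
  rw [mul_zero, ENNReal.tendsto_nhds_zero] at htail
  filter_upwards [htail _ hε2] with n hn
  calc ∫⁻ x, W x ∂(ν n)
      ≤ ∫⁻ x, (ε / 2 + {x : X | δ / 2 < ‖x‖}.indicator (fun _ => B) x) ∂(ν n) := by
        refine lintegral_mono fun x => ?_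
        by_cases hx : δ / 2 < ‖x‖
        · rw [Set.indicator_of_mem (s := {x : X | δ / 2 < ‖x‖}) hx]
          exact (hWB x).trans le_add_self
        · refine (hb x ?_).trans le_self_add
          rw [mem_ball_zero_iff]
          linarith
    _ = ε / 2 + B * ν n {x : X | δ / 2 < ‖x‖} := by
        rw [lintegral_add_left measurable_const, lintegral_indicator_const hms]
        simp
    _ ≤ ε / 2 + ε / 2 := by gcongr
    _ = ε := ENNReal.add_halves ε

/-! ### Weighted remainder estimates -/

section Weight

variable {N : ℕ} {u : EuclideanSpace ℝ (Fin N) → ℝ} {D : EuclideanSpace ℝ (Fin N) → Mat N}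
  {ρ : EuclideanSpace ℝ (Fin N) → ℝ}

lemma isProbabilityMeasure_withDensity_ofReal {X : Type*} [MeasurableSpace X] {μ : Measure X}
    {ρ : X → ℝ} (hρ0 : ∀ x, 0 ≤ ρ x) (hint : Integrable ρ μ) (hone : ∫ x, ρ x ∂μ = 1) :
    IsProbabilityMeasure (μ.withDensity fun x => ENNReal.ofReal (ρ x)) := by
  constructor
  rw [withDensity_apply _ MeasurableSet.univ, Measure.restrict_univ,
    ← ofReal_integral_eq_lintegral_ofReal hint (Eventually.of_forall hρ0), hone,
    ENNReal.ofReal_one]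

lemma aestronglyMeasurable_secondDifference (hu : AEStronglyMeasurable u volume) :
    AEStronglyMeasurable (fun z : EuclideanSpace ℝ (Fin N) × EuclideanSpace ℝ (Fin N) =>
      secondDifference u z.1 z.2) (volume.prod volume) := by
  have h0 := hu.comp_snd (μ := (volume : Measure (EuclideanSpace ℝ (Fin N))))
  have h1 := h0.comp_measurePreserving (measurePreserving_prod_add volume volume)
  have h2 := h0.comp_measurePreserving (measurePreserving_prod_neg_add volume volume)
  have h3 := h0.const_mul 2
  refine ((h1.sub h3).add h2).congr (Eventually.of_forall fun z => ?_)
  simp [secondDifference, add_comm, sub_eq_add_neg]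

/-- The remainder of the second order Taylor formula, divided by `‖h‖²`. -/
def taylorRemainder (u : EuclideanSpace ℝ (Fin N) → ℝ) (D : EuclideanSpace ℝ (Fin N) → Mat N)
    (h x : EuclideanSpace ℝ (Fin N)) : ℝ :=
  (secondDifference u h x - inner ℝ (D x) (tensorSquare h)) / ‖h‖ ^ 2

lemma integrand_eq (x h : EuclideanSpace ℝ (Fin N)) :
    integrand ρ u x h = (ρ h * taylorRemainder u D h x) • kernelMatrix h +
      (ρ h * (inner ℝ (D x) (tensorSquare h) / ‖h‖ ^ 2)) • kernelMatrix h := by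
  rw [← add_smul, integrand, taylorRemainder, secondDifference]
  congr 1
  ring

lemma aestronglyMeasurable_taylorRemainder (hu : AEStronglyMeasurable u volume)
    (hD : AEStronglyMeasurable D volume) :
    AEStronglyMeasurable (fun z : EuclideanSpace ℝ (Fin N) × EuclideanSpace ℝ (Fin N) =>
      taylorRemainder u D z.1 z.2) (volume.prod volume) := by
  have h1 := continuous_tensorSquare (N := N)
  have h2 : AEStronglyMeasurable (fun z : EuclideanSpace ℝ (Fin N) × EuclideanSpace ℝ (Fin N) =>
      (‖z.1‖ ^ 2)⁻¹) (volume.prod volume) :=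
    Measurable.aestronglyMeasurable (by fun_prop)
  have h3 : Continuous fun z : EuclideanSpace ℝ (Fin N) × EuclideanSpace ℝ (Fin N) =>
      tensorSquare z.1 := by fun_prop
  exact ((aestronglyMeasurable_secondDifference hu).sub
    (hD.comp_snd.inner h3.aestronglyMeasurable)).mul h2

lemma aestronglyMeasurable_nonlocalHessian (hρ : AEStronglyMeasurable ρ volume)
    (hu : AEStronglyMeasurable u volume) :
    AEStronglyMeasurable (nonlocalHessian ρ u) volume := by
  have h2 : AEStronglyMeasurable (fun z : EuclideanSpace ℝ (Fin N) × EuclideanSpace ℝ (Fin N) =>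
      (‖z.2‖ ^ 2)⁻¹) (volume.prod volume) :=
    Measurable.aestronglyMeasurable (by fun_prop)
  have h3 : AEStronglyMeasurable (fun z : EuclideanSpace ℝ (Fin N) × EuclideanSpace ℝ (Fin N) =>
      kernelMatrix z.2) (volume.prod volume) :=
    (measurable_kernelMatrix.comp measurable_snd).aestronglyMeasurable
  have h4 : AEStronglyMeasurable (fun z : EuclideanSpace ℝ (Fin N) × EuclideanSpace ℝ (Fin N) =>
      integrand ρ u z.1 z.2) (volume.prod volume) :=
    (((aestronglyMeasurable_secondDifference hu).prod_swap.mul h2).mul hρ.comp_snd).smul h3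
  exact h4.integral_prod_right'.const_smul ((N : ℝ) * ((N : ℝ) + 2) / 2)

/-- The factor `‖h‖²` in the remainder estimate cancels the denominator; at `h = 0` the product is
`0`, so only `≤ 1` is claimed for it. -/
lemma IsWeakHessian.lintegral_taylorRemainder_le (hu : IsWeakHessian u D) {q : ℝ} (hq : 1 ≤ q)
    (h : EuclideanSpace ℝ (Fin N)) :
    ∫⁻ x, ‖taylorRemainder u D h x‖ₑ ^ q ≤ translationModulus q D h := by
  have hc : ‖(‖h‖ ^ 2)⁻¹‖ₑ * ‖h‖ₑ ^ 2 ≤ 1 := by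
    rw [← enorm_norm h, ← enorm_pow, ← enorm_mul, ← ofReal_norm, ENNReal.ofReal_le_one,
      Real.norm_of_nonneg (by positivity)]
    exact inv_mul_le_one
  calc ∫⁻ x, ‖taylorRemainder u D h x‖ₑ ^ q
      = ∫⁻ x, ‖(‖h‖ ^ 2)⁻¹‖ₑ ^ q *
          ‖secondDifference u h x - inner ℝ (D x) (tensorSquare h)‖ₑ ^ q := by
        simp only [taylorRemainder, div_eq_inv_mul, enorm_mul]
        simp only [ENNReal.mul_rpow_of_nonneg _ _ (zero_le_one.trans hq)]
    _ = ‖(‖h‖ ^ 2)⁻¹‖ₑ ^ q *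
          ∫⁻ x, ‖secondDifference u h x - inner ℝ (D x) (tensorSquare h)‖ₑ ^ q :=
        lintegral_const_mul' _ _ (ENNReal.rpow_ne_top_of_nonneg (by positivity) (by finiteness))
    _ ≤ ‖(‖h‖ ^ 2)⁻¹‖ₑ ^ q * ((‖h‖ₑ ^ 2) ^ q * translationModulus q D h) := by
        gcongr
        exact hu.lintegral_secondDifference_sub_le hq h
    _ = (‖(‖h‖ ^ 2)⁻¹‖ₑ * ‖h‖ₑ ^ 2) ^ q * translationModulus q D h := by
        rw [ENNReal.mul_rpow_of_nonneg _ _ (zero_le_one.trans hq), mul_assoc]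
    _ ≤ 1 * translationModulus q D h := by
        gcongr
        exact ENNReal.rpow_le_one hc (by positivity)
    _ = _ := one_mul _

/-- The weight is absorbed into the probability measure `ρ dh`, to which the integral inequality
applies. -/
lemma IsWeakHessian.lintegral_weighted_taylorRemainder_le (hu : IsWeakHessian u D)
    (hρ0 : ∀ x, 0 ≤ ρ x) (hint : Integrable ρ volume) (hone : ∫ x, ρ x = 1) {q : ℝ}
    (hq : 1 ≤ q) :
    ∫⁻ x, (∫⁻ h, ‖ρ h * taylorRemainder u D h x‖ₑ) ^ q ≤
      ∫⁻ h, translationModulus q D h ∂(volume.withDensity fun h => ENNReal.ofReal (ρ h)) := by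
  have := isProbabilityMeasure_withDensity_ofReal hρ0 hint hone
  have hm := aestronglyMeasurable_taylorRemainder hu.locallyIntegrable.aestronglyMeasurable
    hu.locallyIntegrable_hessian.aestronglyMeasurable
  have hac : (volume.withDensity fun h : EuclideanSpace ℝ (Fin N) => ENNReal.ofReal (ρ h)) ≪
      volume := withDensity_absolutelyContinuous _ _
  calc ∫⁻ x, (∫⁻ h, ‖ρ h * taylorRemainder u D h x‖ₑ) ^ q
      = ∫⁻ x, (∫⁻ h, ‖taylorRemainder u D h x‖ₑ
          ∂(volume.withDensity fun h => ENNReal.ofReal (ρ h))) ^ q := by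
        refine lintegral_congr_ae ?_
        filter_upwards [hm.prod_swap.prodMk_left] with x hx
        simp only [Prod.swap_prod_mk] at hx
        rw [lintegral_withDensity_eq_lintegral_mul₀ hint.aemeasurable.ennreal_ofReal hx.enorm]
        simp [enorm_mul, Real.enorm_of_nonneg (hρ0 _)]
    _ ≤ ∫⁻ h, ∫⁻ x, ‖taylorRemainder u D h x‖ₑ ^ q ∂volume
          ∂(volume.withDensity fun h => ENNReal.ofReal (ρ h)) :=
        lintegral_rpow_lintegral_le (F := fun h x => ‖taylorRemainder u D h x‖ₑ)
          (hm.mono_ac (hac.prod Measure.AbsolutelyContinuous.rfl)).enorm hq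
    _ ≤ _ := lintegral_mono fun h => hu.lintegral_taylorRemainder_le hq h

lemma IsWeakHessian.ae_integrable_taylorRemainder (hu : IsWeakHessian u D)
    {p : ℝ≥0∞} (hp1 : 1 ≤ p) (hp : p ≠ ⊤) (hD : MemLp D p volume)
    (hρ0 : ∀ x, 0 ≤ ρ x) (hint : Integrable ρ volume) (hone : ∫ x, ρ x = 1) :
    ∀ᵐ x, Integrable (fun h => ρ h * taylorRemainder u D h x) volume := by
  have := isProbabilityMeasure_withDensity_ofReal hρ0 hint hone
  have hq : 1 ≤ p.toReal := by simpa using ENNReal.toReal_mono hp hp1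
  have hm : AEStronglyMeasurable (fun z : EuclideanSpace ℝ (Fin N) × EuclideanSpace ℝ (Fin N) =>
      ρ z.1 * taylorRemainder u D z.1 z.2) (volume.prod volume) :=
    hint.1.comp_fst.mul (aestronglyMeasurable_taylorRemainder
      hu.locallyIntegrable.aestronglyMeasurable
      hu.locallyIntegrable_hessian.aestronglyMeasurable)
  obtain ⟨B, hB, hWB⟩ := exists_translationModulus_le hp1 hp hD
  have hfin : ∫⁻ x, (∫⁻ h, ‖ρ h * taylorRemainder u D h x‖ₑ) ^ p.toReal ≠ ⊤ := by
    refine ne_top_of_le_ne_top hB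
      ((hu.lintegral_weighted_taylorRemainder_le hρ0 hint hone hq).trans ?_)
    exact (lintegral_mono hWB).trans (by simp)
  filter_upwards [hm.prod_swap.prodMk_left,
    ae_lt_top' (hm.enorm.lintegral_prod_left'.pow_const _) hfin] with x h1 h2
  exact ⟨h1, (ENNReal.rpow_lt_top_iff_of_pos (by positivity)).1 h2⟩

theorem IsWeakHessian.ae_integrable_integrand (hu : IsWeakHessian u D)
    {p : ℝ≥0∞} (hp1 : 1 ≤ p) (hp : p ≠ ⊤) (hD : MemLp D p volume)
    (hρ0 : ∀ x, 0 ≤ ρ x) (hint : Integrable ρ volume) (hone : ∫ x, ρ x = 1) :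
    ∀ᵐ x, Integrable (integrand ρ u x) volume := by
  obtain ⟨C, hC⟩ := exists_norm_kernelMatrix_le N
  filter_upwards [hu.ae_integrable_taylorRemainder hp1 hp hD hρ0 hint hone] with x hx
  refine ((hx.smul_bdd C measurable_kernelMatrix.aestronglyMeasurable
    (Eventually.of_forall hC)).add
      (integrable_mul_inner_smul_kernelMatrix hint (D x))).congr
        (Eventually.of_forall fun h => (integrand_eq x h).symm)

/-- The constant comes from the normalizing factor and the kernel bound only. Its independence of
`ρ` is what allows passage to the limit along `ρ n`. -/
theorem exists_eLpNorm_nonlocalHessian_sub_le (hN : 0 < N) {p : ℝ≥0∞} (hp1 : 1 ≤ p)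
    (hp : p ≠ ⊤) :
    ∃ C : ℝ≥0∞, C ≠ ⊤ ∧ ∀ (ρ u : EuclideanSpace ℝ (Fin N) → ℝ)
      (D : EuclideanSpace ℝ (Fin N) → Mat N), IsWeakHessian u D → MemLp D p volume →
      (∀ x y, ‖x‖ = ‖y‖ → ρ x = ρ y) → (∀ x, 0 ≤ ρ x) → Integrable ρ volume →
      ∫ x, ρ x = 1 →
      eLpNorm (fun x => nonlocalHessian ρ u x - D x) p volume ≤
        C * (∫⁻ h, translationModulus p.toReal D h
          ∂(volume.withDensity fun h => ENNReal.ofReal (ρ h))) ^ (1 / p.toReal) := by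
  obtain ⟨K, hK⟩ := exists_norm_kernelMatrix_le N
  have hp0 : p ≠ 0 := (zero_lt_one.trans_le hp1).ne'
  have hq : 1 ≤ p.toReal := by simpa using ENNReal.toReal_mono hp hp1
  refine ⟨‖(N : ℝ) * (N + 2) / 2‖ₑ * ENNReal.ofReal K, by finiteness, ?_⟩
  intro ρ u D hu hD hrad hρ0 hint hone
  have hpt : ∀ᵐ x, ‖nonlocalHessian ρ u x - D x‖ₑ ≤
      ‖(N : ℝ) * (N + 2) / 2‖ₑ * ENNReal.ofReal K *
        ∫⁻ h, ‖ρ h * taylorRemainder u D h x‖ₑ := by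
    filter_upwards [hu.ae_integrable_taylorRemainder hp1 hp hD hρ0 hint hone,
      hu.ae_symmetric] with x hx hsym
    have hi : Integrable (fun h => (ρ h * taylorRemainder u D h x) • kernelMatrix h) volume :=
      hx.smul_bdd K measurable_kernelMatrix.aestronglyMeasurable
      (Eventually.of_forall hK)
    have heq : nonlocalHessian ρ u x - D x = ((N : ℝ) * (N + 2) / 2) •
        ∫ h, (ρ h * taylorRemainder u D h x) • kernelMatrix h := by
      rw [nonlocalHessian]
      simp only [integrand_eq (D := D)]
      rw [integral_add hi (integrable_mul_inner_smul_kernelMatrix hint (D x)), smul_add,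
        integral_mul_inner_smul_kernelMatrix hN hrad hint hone hsym, add_sub_cancel_right]
    rw [heq, enorm_smul, mul_assoc, ← lintegral_const_mul' _ _ (by finiteness)]
    gcongr
    refine (enorm_integral_le_lintegral_enorm _).trans (lintegral_mono fun h => ?_)
    rw [enorm_smul, mul_comm]
    gcongr
    rw [← ofReal_norm]
    exact ENNReal.ofReal_le_ofReal (hK h)
  rw [eLpNorm_eq_lintegral_rpow_enorm_toReal hp0 hp]
  set c := ‖(N : ℝ) * (N + 2) / 2‖ₑ * ENNReal.ofReal K with hc
  have hcfin : c ≠ ⊤ := by finiteness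
  calc (∫⁻ x, ‖nonlocalHessian ρ u x - D x‖ₑ ^ p.toReal) ^ (1 / p.toReal)
      ≤ (∫⁻ x, c ^ p.toReal * (∫⁻ h, ‖ρ h * taylorRemainder u D h x‖ₑ) ^ p.toReal) ^
          (1 / p.toReal) := by
        refine ENNReal.rpow_le_rpow (lintegral_mono_ae ?_) (by positivity)
        filter_upwards [hpt] with x hx
        rw [← ENNReal.mul_rpow_of_nonneg _ _ (by positivity)]
        gcongr
    _ = (c ^ p.toReal) ^ (1 / p.toReal) *
          (∫⁻ x, (∫⁻ h, ‖ρ h * taylorRemainder u D h x‖ₑ) ^ p.toReal) ^ (1 / p.toReal) := by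
        rw [lintegral_const_mul' _ _ (ENNReal.rpow_ne_top_of_nonneg (by positivity) hcfin),
          ENNReal.mul_rpow_of_nonneg _ _ (by positivity)]
    _ = c * (∫⁻ x, (∫⁻ h, ‖ρ h * taylorRemainder u D h x‖ₑ) ^ p.toReal) ^ (1 / p.toReal) := by
        rw [← ENNReal.rpow_mul, mul_one_div_cancel (by positivity), ENNReal.rpow_one]
    _ ≤ _ := by
        refine mul_le_mul_right (ENNReal.rpow_le_rpow ?_ (by positivity)) c
        exact hu.lintegral_weighted_taylorRemainder_le hρ0 hint hone hq

end Weight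

/-! ### Passage to the limit -/

lemma IsRadialMollifierSeq.integrable {N : ℕ} {ρ : ℕ → EuclideanSpace ℝ (Fin N) → ℝ}
    (hρ : IsRadialMollifierSeq ρ) (n : ℕ) : Integrable (ρ n) volume :=
  Integrable.of_integral_ne_zero (by simp [hρ.integral_eq_one n])

lemma IsRadialMollifierSeq.tendsto_withDensity_tail {N : ℕ}
    {ρ : ℕ → EuclideanSpace ℝ (Fin N) → ℝ} (hρ : IsRadialMollifierSeq ρ) (γ : ℝ) (hγ : 0 < γ) :
    Tendsto (fun n => (volume.withDensity fun h => ENNReal.ofReal (ρ n h)) {x | γ < ‖x‖})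
      atTop (𝓝 0) := by
  have h := ENNReal.tendsto_ofReal (hρ.tendsto_integral_tail γ hγ)
  rw [ENNReal.ofReal_zero] at h
  refine h.congr fun n => ?_
  rw [withDensity_apply _ (measurableSet_lt measurable_const continuous_norm.measurable),
    ofReal_integral_eq_lintegral_ofReal (hρ.integrable n).integrableOn
      (Eventually.of_forall (hρ.nonneg n))]

theorem tendsto_eLpNorm_nonlocalHessian_sub {N : ℕ} (hN : 0 < N) {p : ℝ≥0∞} (hp1 : 1 ≤ p)
    (hp : p ≠ ⊤) {ρ : ℕ → EuclideanSpace ℝ (Fin N) → ℝ} (hρ : IsRadialMollifierSeq ρ)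
    {u : EuclideanSpace ℝ (Fin N) → ℝ} {D : EuclideanSpace ℝ (Fin N) → Mat N}
    (hu : IsWeakHessian u D) (hD : MemLp D p volume) :
    Tendsto (fun n => eLpNorm (fun x => nonlocalHessian (ρ n) u x - D x) p volume)
      atTop (𝓝 0) := by
  obtain ⟨C, hC, hle⟩ := exists_eLpNorm_nonlocalHessian_sub_le hN hp1 hp
  obtain ⟨B, hB, hWB⟩ := exists_translationModulus_le hp1 hp hD
  have hq : 0 < p.toReal := ENNReal.toReal_pos (zero_lt_one.trans_le hp1).ne' hp
  have := fun n => isProbabilityMeasure_withDensity_ofReal (hρ.nonneg n) (hρ.integrable n)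
    (hρ.integral_eq_one n)
  have h1 := tendsto_lintegral_of_concentrating hρ.tendsto_withDensity_tail hB hWB
    (tendsto_translationModulus hp1 hp hD)
  have h2 := (ENNReal.continuous_rpow_const (y := 1 / p.toReal)).tendsto' (0 : ℝ≥0∞) 0
    (ENNReal.zero_rpow_of_pos (by positivity))
  have h3 := ENNReal.Tendsto.const_mul (a := C) (h2.comp h1) (Or.inr hC)
  rw [mul_zero] at h3
  exact tendsto_of_tendsto_of_tendsto_of_le_of_le tendsto_const_nhds h3 (fun _ => zero_le)
    fun n => hle _ _ _ hu hD (hρ.radial n) (hρ.nonneg n) (hρ.integrable n) (hρ.integral_eq_one n)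

theorem memLp_nonlocalHessian {N : ℕ} (hN : 0 < N) {p : ℝ≥0∞} (hp1 : 1 ≤ p)
    (hp : p ≠ ⊤) {ρ u : EuclideanSpace ℝ (Fin N) → ℝ} {D : EuclideanSpace ℝ (Fin N) → Mat N}
    (hu : IsWeakHessian u D) (hD : MemLp D p volume) (hrad : ∀ x y, ‖x‖ = ‖y‖ → ρ x = ρ y)
    (hρ0 : ∀ x, 0 ≤ ρ x) (hint : Integrable ρ volume) (hone : ∫ x, ρ x = 1) :
    MemLp (nonlocalHessian ρ u) p volume := by
  obtain ⟨C, hC, hle⟩ := exists_eLpNorm_nonlocalHessian_sub_le hN hp1 hp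
  obtain ⟨B, hB, hWB⟩ := exists_translationModulus_le hp1 hp hD
  have := isProbabilityMeasure_withDensity_ofReal hρ0 hint hone
  have hm := aestronglyMeasurable_nonlocalHessian hint.1 hu.locallyIntegrable.aestronglyMeasurable
  have hfin : ∫⁻ h, translationModulus p.toReal D h
      ∂(volume.withDensity fun h => ENNReal.ofReal (ρ h)) ≠ ⊤ :=
    ne_top_of_le_ne_top hB ((lintegral_mono hWB).trans (by simp))
  have hsub : MemLp (fun x => nonlocalHessian ρ u x - D x) p volume :=
    ⟨hm.sub hD.1, (hle _ _ _ hu hD hrad hρ0 hint hone).trans_lt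
      (ENNReal.mul_lt_top hC.lt_top (ENNReal.rpow_lt_top_of_nonneg (by positivity) hfin))⟩
  -- Both the error and `D` lie in `L^p`, hence so does their sum.
  refine (hsub.add hD).ae_eq (Eventually.of_forall fun x => ?_)
  simp

end NonlocalHessian

end

theorem theorem1p5 {N : ℕ} (p : ℝ≥0∞) (hp1 : 1 ≤ p) (hp : p ≠ ⊤)
    (ρ : ℕ → EuclideanSpace ℝ (Fin N) → ℝ) (hρ : NonlocalHessian.IsRadialMollifierSeq ρ)
    (u : EuclideanSpace ℝ (Fin N) → ℝ) (hu : NonlocalHessian.MemW2p p u) :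
    (∀ n, ∀ᵐ x : EuclideanSpace ℝ (Fin N),
        Integrable (NonlocalHessian.integrand (ρ n) u x) volume) ∧
      (∀ n, MemLp (NonlocalHessian.nonlocalHessian (ρ n) u) p volume) ∧
      ∀ D : EuclideanSpace ℝ (Fin N) → NonlocalHessian.Mat N,
        NonlocalHessian.IsWeakHessian u D →
          MemLp D p volume ∧
            Tendsto (fun n =>
              eLpNorm (fun x => NonlocalHessian.nonlocalHessian (ρ n) u x - D x) p volume)
              atTop (𝓝 0) := by
  obtain ⟨D₀, hD₀p, hD₀⟩ := hu.exists_weakHessian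
  have hD : ∀ D : EuclideanSpace ℝ (Fin N) → NonlocalHessian.Mat N,
      NonlocalHessian.IsWeakHessian u D → MemLp D p volume :=
    fun D hD => hD₀p.ae_eq (hD₀.ae_eq hD)
  -- The moment normalization divides by `N`. In dimension zero the matrices are empty and all
  -- matrix-valued functions vanish.
  rcases Nat.eq_zero_or_pos N with rfl | hN
  · have hz : ∀ f : EuclideanSpace ℝ (Fin 0) → NonlocalHessian.Mat 0, f = 0 := fun f =>
      Subsingleton.elim _ _
    refine ⟨fun n => Eventually.of_forall fun x => ?_, fun n => ?_, fun D h => ⟨hD D h, ?_⟩⟩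
    · rw [hz (NonlocalHessian.integrand (ρ n) u x)]
      exact integrable_zero _ _ _
    · rw [hz (NonlocalHessian.nonlocalHessian (ρ n) u)]
      exact MemLp.zero
    · simp only [fun n => hz fun x => NonlocalHessian.nonlocalHessian (ρ n) u x - D x,
        eLpNorm_zero]
      exact tendsto_const_nhds
  · exact ⟨fun n => hD₀.ae_integrable_integrand hp1 hp hD₀p (hρ.nonneg n) (hρ.integrable n)
        (hρ.integral_eq_one n),
      fun n => NonlocalHessian.memLp_nonlocalHessian hN hp1 hp hD₀ hD₀p (hρ.radial n)
        (hρ.nonneg n) (hρ.integrable n) (hρ.integral_eq_one n),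
      fun D h => ⟨hD D h, NonlocalHessian.tendsto_eLpNorm_nonlocalHessian_sub hN hp1 hp hρ h
        (hD D h)⟩⟩
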